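/- Let $\Bbbk$ be a commutative ring. An object $X$ of a $\Bbbk$-linear category is called scalar if the map $\Bbbk\to\mathrm{End}(X)$, $\alpha\mapsto\alpha\,\mathrm{id}_X$, is bijective. A fusion category over $\Bbbk$ is a rigid monoidal $\Bbbk$-linear category with finite direct sums and $\Bbbk$-bilinear monoidal product such that every object is a finite direct sum of scalar objects, $\mathrm{Hom}(i,j)=0$ for any non-isomorphic scalar objects $i,j$, there are finitely many isomorphism classes of scalar objects, and the unit object $\mathbb 1$ is scalar. A pivotal category is a rigid monoidal category in which every object $X$ is given a dual object $X^*$ that is both a left dual, via $\mathrm{ev}_X\colon X^*\otimes X\to\mathbb 1$ and $\mathrm{coev}_X\colon\mathbb 1\to X\otimes X^*$, and a right dual, via $\widetilde{\mathrm{ev}}_X\colon X\otimes X^*\to\mathbb 1$ and $\widetilde{\mathrm{coev}}_X\colon\mathbb 1\to X^*\otimes X$, such that the resulting left and right dual functors coincide as monoidal functors. The left and right dimensions of $X$ are $\dim_l(X)=\mathrm{ev}_X\circ\widetilde{\mathrm{coev}}_X$ and $\dim_r(X)=\widetilde{\mathrm{ev}}_X\circ\mathrm{coev}_X$. The dimension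 of a pivotal fusion category $\mathcal C$ over $\Bbbk$ is $\dim(\mathcal C)=\sum_{i\in I}\dim_r(i)\dim_l(i)\in\mathrm{End}(\mathbb 1)=\Bbbk$, where $I$ is a set of representatives of the isomorphism classes of scalar objects of $\mathcal C$. Theorem. Let $\Bbbk$ be a field, $\mathcal C$ a pivotal fusion category over $\Bbbk$, and $\mathcal Z(\mathcal C)$ its center, that is, the braided $\Bbbk$-linear monoidal category of half braidings $(A,\sigma)$, where $A$ is an object of $\mathcal C$ and $\sigma=\{\sigma_X\colon A\otimes X\to X\otimes A\}_{X\in\mathcal C}$ is a natural isomorphism with $\sigma_{X\otimes Y}=(\mathrm{id}_X\otimes\sigma_Y)(\sigma_X\otimes\mathrm{id}_Y)$ (up to associativity constraints), and whose morphisms are the morphisms of $\mathcal C$ compatible with the half braidings. Then $\mathcal Z(\mathcal C)$ is an abelian category, and: (a) $\mathcal Z(\mathcal C)$ is semisimple (i.e. every object is a direct sum of simple objects) if and only if $\dim(\mathcal C)\neq 0$. (b) If $\Bbbk$ is algebraically closed, then $\mathcal Z(\mathcal C)$ is a fusion category over $\Bbbk$ if and only if $\dim(\mathcal C)\neq 0$.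 -/

import Mathlib

open CategoryTheory CategoryTheory.Limits CategoryTheory.MonoidalCategory

universe w v u

namespace FusionCenter


section Pivotal

/-- A pivotal structure on a monoidal category (and so, in particular, the rigidity of that
category). Every object `X` has a dual object `X* = dual X` with morphisms

* `X* ⊗ X ⟶ 𝟙`, `𝟙 ⟶ X ⊗ X*` making `X*` a left dual of `X` (this is `leftPairing X`);
* `X ⊗ X* ⟶ 𝟙`, `𝟙 ⟶ X* ⊗ X` making `X*` a right dual of `X` (this is `rightPairing X`);

and the left and right dual functors so defined are equal as monoidal functors: they agree on
morphisms, and their constraints `Y* ⊗ X* ≅ (X ⊗ Y)*` and `𝟙 ≅ 𝟙*` are equal.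

(Mathlib's `ExactPairing X Y` consists of `𝟙 ⟶ X ⊗ Y` and `Y ⊗ X ⟶ 𝟙` subject to the two
zigzag identities; Mathlib calls such a `Y` a right dual of `X`.) -/
class PivotalCategory (C : Type u) [Category.{v} C] [MonoidalCategory C] where
  dual : C → C
  leftPairing : ∀ X : C, ExactPairing X (dual X)
  rightPairing : ∀ X : C, ExactPairing (dual X) X
  mate_eq : ∀ {X Y : C} (f : X ⟶ Y),
    (@rightAdjointMate C _ _ X Y (@HasRightDual.mk C _ _ X (dual X) (leftPairing X))
      (@HasRightDual.mk C _ _ Y (dual Y) (leftPairing Y)) f : dual Y ⟶ dual X) =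
    @leftAdjointMate C _ _ X Y (@HasLeftDual.mk C _ _ X (dual X) (rightPairing X))
      (@HasLeftDual.mk C _ _ Y (dual Y) (rightPairing Y)) f
  tensor_eq : ∀ X Y : C,
    (rightDualIso
      (@ExactPairing.tensor C _ _ X Y (dual X) (dual Y) (leftPairing X) (leftPairing Y))
      (leftPairing (X ⊗ Y))).hom =
    (leftDualIso
      (@ExactPairing.tensor C _ _ (dual Y) (dual X) Y X (rightPairing Y) (rightPairing X))
      (rightPairing (X ⊗ Y))).hom
  unit_eq :
    (rightDualIso (exactPairingUnit : ExactPairing (𝟙_ C) (𝟙_ C)) (leftPairing (𝟙_ C))).hom =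
    (leftDualIso (exactPairingUnit : ExactPairing (𝟙_ C) (𝟙_ C)) (rightPairing (𝟙_ C))).hom

variable {C : Type u} [Category.{v} C] [MonoidalCategory C] [PivotalCategory C]

/-- The left evaluation `X* ⊗ X ⟶ 𝟙`. -/
def lev (X : C) : PivotalCategory.dual X ⊗ X ⟶ 𝟙_ C :=
  (PivotalCategory.leftPairing X).evaluation'

/-- The left coevaluation `𝟙 ⟶ X ⊗ X*`. -/
def lcoev (X : C) : 𝟙_ C ⟶ X ⊗ PivotalCategory.dual X :=
  (PivotalCategory.leftPairing X).coevaluation'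

/-- The right evaluation `X ⊗ X* ⟶ 𝟙`. -/
def rev (X : C) : X ⊗ PivotalCategory.dual X ⟶ 𝟙_ C :=
  (PivotalCategory.rightPairing X).evaluation'

/-- The right coevaluation `𝟙 ⟶ X* ⊗ X`. -/
def rcoev (X : C) : 𝟙_ C ⟶ PivotalCategory.dual X ⊗ X :=
  (PivotalCategory.rightPairing X).coevaluation'

/-- The left trace of an endomorphism. -/
def leftTrace {X : C} (f : X ⟶ X) : 𝟙_ C ⟶ 𝟙_ C :=
  rcoev X ≫ PivotalCategory.dual X ◁ f ≫ lev X

/-- The right trace of an endomorphism. -/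
def rightTrace {X : C} (f : X ⟶ X) : 𝟙_ C ⟶ 𝟙_ C :=
  lcoev X ≫ f ▷ PivotalCategory.dual X ≫ rev X

/-- The left dimension of an object. -/
def leftDim (X : C) : 𝟙_ C ⟶ 𝟙_ C := leftTrace (𝟙 X)

/-- The right dimension of an object. -/
def rightDim (X : C) : 𝟙_ C ⟶ 𝟙_ C := rightTrace (𝟙 X)

end Pivotal

section Fusion

variable (k : Type w) [CommRing k] {C : Type u} [Category.{v} C] [Preadditive C] [Linear k C]

/-- An object `X` is scalar if `k → End X`, `a ↦ a • 𝟙 X`, is bijective. -/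
def IsScalar (X : C) : Prop :=
  Function.Bijective fun a : k => (a • 𝟙 X : X ⟶ X)

/-- For a scalar object `X`, the endomorphism `f` of `X` seen as an element of `k`: the unique
`a` with `a • 𝟙 X = f`. -/
noncomputable def IsScalar.coeff {k : Type w} [CommRing k] {C : Type u} [Category.{v} C]
    [Preadditive C] [Linear k C] {X : C} (hX : IsScalar k X) (f : X ⟶ X) : k :=
  (Equiv.ofBijective _ hX).symm f

variable (C) in
/-- The set of isomorphism classes of scalar objects of `C`. -/
def scalarClasses : Set (Quotient (isIsomorphicSetoid C)) :=
  (Quotient.mk (isIsomorphicSetoid C)) '' {X : C | IsScalar k X}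

variable (C) in
/-- `C` is a fusion category over the commutative ring `k`. -/
class FusionCategory [MonoidalCategory C] : Prop where
  /-- The tensor product is biadditive. -/
  [monoidalPreadditive : MonoidalPreadditive C]
  /-- The tensor product is `k`-bilinear. -/
  [monoidalLinear : MonoidalLinear k C]
  [hasFiniteBiproducts : HasFiniteBiproducts C]
  /-- Every object has a left and a right dual. -/
  rigid : Nonempty (RigidCategory C)
  /-- Every object is a finite direct sum of scalar objects. -/
  exists_iso_biproduct : ∀ X : C, ∃ (n : ℕ) (S : Fin n → C),
    (∀ j, IsScalar k (S j)) ∧ Nonempty (X ≅ ⨁ S)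
  hom_eq_zero : ∀ i j : C, IsScalar k i → IsScalar k j → ¬ Nonempty (i ≅ j) →
    ∀ f : i ⟶ j, f = 0
  finite_scalarClasses : (scalarClasses k C).Finite
  unit_scalar : IsScalar k (𝟙_ C)

variable (C) in
/-- The dimension of a pivotal fusion category: the sum of `dim_r(i) dim_l(i)` over a set of
representatives `i` of the isomorphism classes of scalar objects, where `End(𝟙)` is identified
with `k`. -/
noncomputable def fusionDim [MonoidalCategory C] [PivotalCategory C] [FusionCategory k C] : k :=
  ∑ q ∈ (FusionCategory.finite_scalarClasses (k := k) (C := C)).toFinset,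
    (FusionCategory.unit_scalar (k := k) (C := C)).coeff (rightDim q.out) *
      (FusionCategory.unit_scalar (k := k) (C := C)).coeff (leftDim q.out)

end Fusion

section Abelian

variable (C : Type u) [Category.{v} C]

/-- A preadditive category is abelian (with its given addition of morphisms). -/
def IsAbelian [P : Preadditive C] : Prop :=
  ∃ A : Abelian C, A.toPreadditive = P

/-- Every object is a direct sum of simple objects. (Families indexed by `Type v` suffice: in
a direct sum `X` of simple objects the index set embeds into `X ⟶ X`, by sending an index to the
corresponding projector.) -/
def IsSemisimple [HasZeroMorphisms C] : Prop :=
  ∀ X : C, ∃ (ι : Type v) (S : ι → C) (c : Cofan S),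
    (∀ i, Simple (S i)) ∧ Nonempty (IsColimit c) ∧ Nonempty (X ≅ c.pt)

end Abelian

/-! The center of a `k`-linear monoidal category, with the addition and the scalar multiplication
of morphisms of the underlying category. -/

section Center

variable {C : Type u} [Category.{v} C] [MonoidalCategory C] [Preadditive C] [MonoidalPreadditive C]

instance (X Y : Center C) : Zero (X ⟶ Y) := ⟨⟨0, by simp⟩⟩

instance (X Y : Center C) : Add (X ⟶ Y) := ⟨fun f g => ⟨f.f + g.f, by simp⟩⟩

instance (X Y : Center C) : Neg (X ⟶ Y) :=
  ⟨fun f => ⟨-f.f, fun U => by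
    have h₁ : (-f.f) ▷ U = -(f.f ▷ U) := ((tensorRight U).map_neg (f := f.f) :)
    have h₂ : U ◁ (-f.f) = -(U ◁ f.f) := ((tensorLeft U).map_neg (f := f.f) :)
    simp [h₁, h₂]⟩⟩

@[simp] theorem center_zero_f (X Y : Center C) : (0 : X ⟶ Y).f = 0 := rfl

@[simp] theorem center_add_f {X Y : Center C} (f g : X ⟶ Y) : (f + g).f = f.f + g.f := rfl

@[simp] theorem center_neg_f {X Y : Center C} (f : X ⟶ Y) : (-f).f = -f.f := rfl

instance (X Y : Center C) : AddCommGroup (X ⟶ Y) where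
  add_assoc f g h := Center.ext _ _ (add_assoc f.f g.f h.f)
  zero_add f := Center.ext _ _ (zero_add f.f)
  add_zero f := Center.ext _ _ (add_zero f.f)
  neg_add_cancel f := Center.ext _ _ (neg_add_cancel f.f)
  add_comm f g := Center.ext _ _ (add_comm f.f g.f)
  nsmul := nsmulRec
  zsmul := zsmulRec

instance : Preadditive (Center C) where
  add_comp _ _ _ f f' g := Center.ext _ _ (Preadditive.add_comp _ _ _ f.f f'.f g.f)
  comp_add _ _ _ f g g' := Center.ext _ _ (Preadditive.comp_add _ _ _ f.f g.f g'.f)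

variable (k : Type w) [CommRing k] [Linear k C] [MonoidalLinear k C]

instance (X Y : Center C) : SMul k (X ⟶ Y) := ⟨fun a f => ⟨a • f.f, by simp⟩⟩

@[simp] theorem center_smul_f {X Y : Center C} (a : k) (f : X ⟶ Y) : (a • f).f = a • f.f := rfl

instance (X Y : Center C) : Module k (X ⟶ Y) where
  one_smul f := Center.ext _ _ (one_smul k f.f)
  mul_smul a b f := Center.ext _ _ (mul_smul a b f.f)
  smul_zero a := Center.ext _ _ (smul_zero a)
  smul_add a f g := Center.ext _ _ (smul_add a f.f g.f)
  add_smul a b f := Center.ext _ _ (add_smul a b f.f)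
  zero_smul f := Center.ext _ _ (zero_smul k f.f)

instance : Linear k (Center C) where
  smul_comp _ _ _ a f g := Center.ext _ _ (Linear.smul_comp _ _ _ a f.f g.f)
  comp_smul _ _ _ f a g := Center.ext _ _ (Linear.comp_smul _ _ _ f.f a g.f)

end Center

end FusionCenter

/-!
A semisimple category is von Neumann regular: every morphism `f` has some `g` with `f ≫ g ≫ f = f`.
Tensoring with a dualizable object is exact, so kernels and cokernels in the center are those of
the underlying category, and the center is abelian.

If the center is semisimple, consider the cofree object `R` on the unit, the value at the unit of
the right adjoint of the forgetful functor. The unit map `η : 𝟙 ⟶ R` of the center is nonzero and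
the unit is simple, so `η` has a retraction `r`. Natural endomorphisms `φ` of the identity functor
are points of `R`, with the identity corresponding to `η`. As `r` is compatible with the half
braidings, encircling a strand by `W` multiplies `φ ≫ r` by `dim_r W`. Encircling the projection
onto the unit component by a scalar object yields, up to a left dimension, the projection onto the
component of that object, so summing over all scalar objects shows that `η ≫ r = 1` is a multiple
of the dimension of the category.

Conversely, if the dimension is invertible, conjugating a morphism of the underlying category with
half braidings and taking the partial trace over the sum of the scalar objects, weighted by their
left dimensions, gives a morphism of the center (by a handle slide), and dividing by the dimension
makes this a projection onto the morphisms of the center. As in Maschke's theorem, averaging a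
quasi-inverse shows that the center is von Neumann regular, and with finite-dimensional morphism
spaces this gives semisimplicity. Every scalar object of the center maps nontrivially to the cofree
object on some scalar object of the underlying category, so there are finitely many of them up to
isomorphism.
-/

namespace FusionCenter

/-! ### Complete families of scalar objects -/

section Scalar

variable {k : Type w} [CommRing k] {C : Type u} [Category.{v} C] [Preadditive C] [Linear k C]

theorem IsScalar.exists_smul {X : C} (hX : IsScalar k X) (f : X ⟶ X) : ∃ c : k, f = c • 𝟙 X :=
  (hX.2 f).imp fun _ h => h.symm

theorem IsScalar.coeff_smul_id {X : C} (hX : IsScalar k X) (f : X ⟶ X) : hX.coeff f • 𝟙 X = f :=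
  (Equiv.ofBijective _ hX).apply_symm_apply f

theorem IsScalar.id_ne_zero [Nontrivial k] {X : C} (hX : IsScalar k X) : 𝟙 X ≠ 0 := fun h =>
  zero_ne_one (hX.1 (by simp [h] : (0 : k) • 𝟙 X = (1 : k) • 𝟙 X))

theorem IsScalar.of_iso {X Y : C} (hX : IsScalar k X) (e : X ≅ Y) : IsScalar k Y := by
  refine ⟨fun a b h => hX.1 ?_, fun f => ?_⟩
  · simpa using congrArg (fun f => e.hom ≫ f ≫ e.inv) h
  · obtain ⟨c, hc⟩ := hX.exists_smul (e.hom ≫ f ≫ e.inv)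
    exact ⟨c, by simpa using (congrArg (fun f => e.inv ≫ f ≫ e.hom) hc).symm⟩

end Scalar

section VonNeumannRegular

/-- A category is von Neumann regular if every morphism `f` has a quasi-inverse `g`, that is,
`f ≫ g ≫ f = f`. -/
def IsVonNeumannRegular (C : Type u) [Category.{v} C] : Prop :=
  ∀ ⦃X Y : C⦄ (f : X ⟶ Y), ∃ g : Y ⟶ X, f ≫ g ≫ f = f

namespace IsVonNeumannRegular

variable {C : Type u} [Category.{v} C] (hC : IsVonNeumannRegular C)
include hC

theorem exists_retraction {X Y : C} (f : X ⟶ Y) [Mono f] : ∃ r : Y ⟶ X, f ≫ r = 𝟙 X := by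
  obtain ⟨g, hg⟩ := hC f
  exact ⟨g, by rw [← cancel_mono f, Category.assoc, hg, Category.id_comp]⟩

theorem exists_section {X Y : C} (f : X ⟶ Y) [Epi f] : ∃ s : Y ⟶ X, s ≫ f = 𝟙 Y := by
  obtain ⟨g, hg⟩ := hC f
  exact ⟨g, by rw [← cancel_epi f, hg, Category.comp_id]⟩

variable [Preadditive C]

theorem isNormalMonoCategory : IsNormalMonoCategory C where
  normalMonoOfMono {X Y} f _ := by
    obtain ⟨r, hr⟩ := hC.exists_retraction f
    exact ⟨⟨Y, 𝟙 Y - r ≫ f, by simp [reassoc_of% hr], KernelFork.IsLimit.ofι f _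
      (fun t _ => t ≫ r)
      (fun t ht => by simpa [sub_eq_zero, @eq_comm _ t] using ht)
      (fun t _ m hm => by simp [← hm, hr])⟩⟩

theorem isNormalEpiCategory : IsNormalEpiCategory C where
  normalEpiOfEpi {X Y} f _ := by
    obtain ⟨s, hs⟩ := hC.exists_section f
    exact ⟨⟨X, 𝟙 X - f ≫ s, by simp [hs], CokernelCofork.IsColimit.ofπ f _
      (fun t _ => s ≫ t)
      (fun t ht => by simpa [sub_eq_zero, @eq_comm _ t] using ht)
      (fun t _ m hm => by simp [← hm, reassoc_of% hs])⟩⟩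

variable [IsIdempotentComplete C]

theorem hasKernels : HasKernels C where
  has_limit {X Y} f := by
    obtain ⟨g, hg⟩ := hC f
    obtain ⟨K, i, p, hip, hpi⟩ :=
      IsIdempotentComplete.idempotents_split X (𝟙 X - f ≫ g) (by simp [reassoc_of% hg])
    have hif : i ≫ f = 0 := by
      have : i ≫ f = i ≫ (p ≫ i) ≫ f := by simp [reassoc_of% hip]
      rw [this, hpi]
      simp [hg]
    exact ⟨_, KernelFork.IsLimit.ofι i hif (fun t _ => t ≫ p)
      (fun t ht => by simp [hpi, reassoc_of% ht]) (fun t _ m hm => by simp [← hm, hip])⟩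

theorem hasCokernels : HasCokernels C where
  has_colimit {X Y} f := by
    obtain ⟨g, hg⟩ := hC f
    obtain ⟨Q, i, p, hip, hpi⟩ :=
      IsIdempotentComplete.idempotents_split Y (𝟙 Y - g ≫ f) (by simp [hg])
    have hfp : f ≫ p = 0 := by
      have : f ≫ p = f ≫ (p ≫ i) ≫ p := by simp [hip]
      rw [this, hpi]
      simp [reassoc_of% hg]
    exact ⟨_, CokernelCofork.IsColimit.ofπ p hfp (fun t _ => i ≫ t)
      (fun t ht => by simp [reassoc_of% hpi, ht]) (fun t _ m hm => by simp [← hm, reassoc_of% hip])⟩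

theorem isAbelian [HasFiniteBiproducts C] : IsAbelian C :=
  have := hC.hasKernels
  have := hC.hasCokernels
  have := hC.isNormalMonoCategory
  have := hC.isNormalEpiCategory
  have : HasFiniteProducts C := inferInstance
  ⟨{ }, rfl⟩

end IsVonNeumannRegular

end VonNeumannRegular

section ScalarFamily

theorem exists_linearMap_quasiInverse {k V W : Type*} [DivisionRing k] [AddCommGroup V]
    [Module k V] [AddCommGroup W] [Module k W] (f : V →ₗ[k] W) :
    ∃ g : W →ₗ[k] V, ∀ x, f (g (f x)) = f x := by
  obtain ⟨t, ht⟩ := f.rangeRestrict.exists_rightInverse_of_surjective f.range_rangeRestrict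
  obtain ⟨g, hg⟩ := LinearMap.exists_extend t
  refine ⟨g, fun x => ?_⟩
  have h₁ := LinearMap.congr_fun hg (f.rangeRestrict x)
  have h₂ := congrArg Subtype.val (LinearMap.congr_fun ht (f.rangeRestrict x))
  exact (congrArg f h₁).trans h₂

variable (k : Type w) [CommRing k] {C : Type u} [Category.{v} C] [Preadditive C] [Linear k C]
  {I : Type*}

/-- A family of pairwise orthogonal scalar objects such that every object is a retract of a finite
direct sum of members of the family. In a fusion category, representatives of the isomorphism
classes of scalar objects form such a family. -/
structure IsCompleteScalarFamily (s : I → C) : Prop where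
  scalar : ∀ i, IsScalar k (s i)
  hom_eq_zero : ∀ i j, i ≠ j → ∀ f : s i ⟶ s j, f = 0
  complete : ∀ X : C, ∃ (n : ℕ) (c : Fin n → I) (π : ∀ a, X ⟶ s (c a)) (ι : ∀ a, s (c a) ⟶ X),
    ∑ a, π a ≫ ι a = 𝟙 X

namespace IsCompleteScalarFamily

variable {k} {s : I → C} (hs : IsCompleteScalarFamily k s)
include hs

theorem hom_ext_of_comp_left {X Y : C} {f g : X ⟶ Y} (h : ∀ i (x : s i ⟶ X), x ≫ f = x ≫ g) :
    f = g := by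
  obtain ⟨n, c, π, ι, hX⟩ := hs.complete X
  rw [← Category.id_comp f, ← Category.id_comp g, ← hX]
  simp only [Preadditive.sum_comp, Category.assoc, h]

theorem hom_ext_of_comp_right {X Y : C} {f g : X ⟶ Y} (h : ∀ i (y : Y ⟶ s i), f ≫ y = g ≫ y) :
    f = g := by
  obtain ⟨n, c, π, ι, hY⟩ := hs.complete Y
  rw [← Category.comp_id f, ← Category.comp_id g, ← hY]
  simp only [Preadditive.comp_sum, ← Category.assoc, h]

theorem exists_comp_ne_zero {X Y : C} {f : X ⟶ Y} (hf : f ≠ 0) :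
    ∃ (i : I) (x : s i ⟶ X), x ≫ f ≠ 0 := by
  by_contra! h
  exact hf (hs.hom_ext_of_comp_left fun i x => by simp [h])

theorem exists_hom {X Y : C} (g : ∀ i, (s i ⟶ X) →ₗ[k] (s i ⟶ Y)) :
    ∃ f : X ⟶ Y, ∀ i (x : s i ⟶ X), x ≫ f = g i x := by
  obtain ⟨n, c, π, ι, hX⟩ := hs.complete X
  have map_comp {i j} (x : s i ⟶ s j) (z : s j ⟶ X) : x ≫ g j z = g i (x ≫ z) := by
    obtain rfl | hij := eq_or_ne i j
    · obtain ⟨a, rfl⟩ := (hs.scalar i).exists_smul x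
      simp
    · simp [hs.hom_eq_zero i j hij x]
  refine ⟨∑ a, π a ≫ g (c a) (ι a), fun i x => ?_⟩
  calc x ≫ ∑ a, π a ≫ g (c a) (ι a)
      = g i (x ≫ ∑ a, π a ≫ ι a) := by
        simp only [Preadditive.comp_sum, map_sum, ← map_comp, ← Category.assoc]
    _ = g i x := by rw [hX, Category.comp_id]

theorem exists_natTrans {D : Type*} [Category* D] [Preadditive D] [Linear k D] (F G : C ⥤ D)
    [F.Additive] [F.Linear k] [G.Additive] [G.Linear k]
    (φ : ∀ i, F.obj (s i) ⟶ G.obj (s i)) : ∃ α : F ⟶ G, ∀ i, α.app (s i) = φ i := by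
  choose n c π ι hX using hs.complete
  have naturality {i j} (g : s i ⟶ s j) : F.map g ≫ φ j = φ i ≫ G.map g := by
    obtain rfl | hij := eq_or_ne i j
    · obtain ⟨a, rfl⟩ := (hs.scalar i).exists_smul g
      simp [Functor.map_smul]
    · simp [hs.hom_eq_zero i j hij g]
  let α (X : C) : F.obj X ⟶ G.obj X := ∑ a, F.map (π X a) ≫ φ (c X a) ≫ G.map (ι X a)
  have map_comp_α {i Y} (x : s i ⟶ Y) : F.map x ≫ α Y = φ i ≫ G.map x :=
    calc F.map x ≫ α Y
        = ∑ b, F.map (x ≫ π Y b) ≫ φ (c Y b) ≫ G.map (ι Y b) := by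
          simp only [α, Preadditive.comp_sum, Functor.map_comp, Category.assoc]
      _ = φ i ≫ G.map (x ≫ ∑ b, π Y b ≫ ι Y b) := by
          simp only [reassoc_of% naturality]
          simp only [Preadditive.comp_sum, Functor.map_sum, Functor.map_comp, Category.assoc]
      _ = φ i ≫ G.map x := by rw [hX, Category.comp_id]
  refine ⟨⟨α, fun X Y f => ?_⟩, fun i => by simpa using map_comp_α (𝟙 (s i))⟩
  calc F.map f ≫ α Y
      = F.map ((∑ a, π X a ≫ ι X a) ≫ f) ≫ α Y := by rw [hX, Category.id_comp]
    _ = ∑ a, F.map (π X a) ≫ F.map (ι X a ≫ f) ≫ α Y := by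
        simp only [Preadditive.sum_comp, Functor.map_sum, Functor.map_comp, Category.assoc]
    _ = α X ≫ G.map f := by
        simp only [map_comp_α]
        simp only [α, Preadditive.sum_comp, Functor.map_comp, Category.assoc]

theorem natTrans_ext {D : Type*} [Category* D] [Preadditive D] {F G : C ⥤ D} [F.Additive]
    {α β : F ⟶ G} (h : ∀ i, α.app (s i) = β.app (s i)) : α = β := by
  ext X
  obtain ⟨n, c, π, ι, hX⟩ := hs.complete X
  rw [← Category.id_comp (α.app X), ← Category.id_comp (β.app X), ← F.map_id, ← hX]
  simp [Functor.map_sum, Preadditive.sum_comp, h]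

theorem finite_hom (X Y : C) : Module.Finite k (X ⟶ Y) := by
  obtain ⟨n, c, π, ι, hX⟩ := hs.complete X
  obtain ⟨m, d, π', ι', hY⟩ := hs.complete Y
  have finite_hom_scalar (i j : I) : Module.Finite k (s i ⟶ s j) := by
    obtain rfl | hij := eq_or_ne i j
    · exact Module.Finite.of_surjective (LinearMap.toSpanSingleton k _ (𝟙 (s i))) fun f =>
        ((hs.scalar i).exists_smul f).imp fun a ha => ha.symm
    · have : Subsingleton (s i ⟶ s j) := ⟨fun f g => by simp [hs.hom_eq_zero i j hij]⟩
      infer_instance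
  let Φ : (∀ a b, s (c a) ⟶ s (d b)) →ₗ[k] (X ⟶ Y) :=
    { toFun := fun f => ∑ a, ∑ b, π a ≫ f a b ≫ ι' b
      map_add' := fun f g => by simp [Finset.sum_add_distrib]
      map_smul' := fun r f => by simp [Finset.smul_sum] }
  refine Module.Finite.of_surjective Φ fun f => ⟨fun a b => ι a ≫ f ≫ π' b, ?_⟩
  calc ∑ a, ∑ b, π a ≫ (ι a ≫ f ≫ π' b) ≫ ι' b
      = (∑ a, π a ≫ ι a) ≫ f ≫ ∑ b, π' b ≫ ι' b := by
        simp only [Preadditive.sum_comp, Preadditive.comp_sum, Category.assoc]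
        exact Finset.sum_comm
    _ = f := by simp [hX, hY]

end IsCompleteScalarFamily

end ScalarFamily

namespace IsCompleteScalarFamily

variable {k : Type w} [Field k] {C : Type u} [Category.{v} C] [Preadditive C] [Linear k C]
  {I : Type*} {s : I → C} (hs : IsCompleteScalarFamily k s)
include hs

theorem isVonNeumannRegular : IsVonNeumannRegular C := by
  intro X Y f
  choose g hg using fun i => exists_linearMap_quasiInverse (Linear.rightComp k (s i) f)
  obtain ⟨g', hg'⟩ := hs.exists_hom g
  refine ⟨g', hs.hom_ext_of_comp_left fun i x => ?_⟩
  rw [← Category.assoc, ← Category.assoc, hg']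
  exact hg i x

theorem exists_retraction {X : C} {i : I} (x : s i ⟶ X) (hx : x ≠ 0) :
    ∃ y : X ⟶ s i, x ≫ y = 𝟙 (s i) := by
  obtain ⟨g, hg⟩ := hs.isVonNeumannRegular x
  obtain ⟨a, ha⟩ := (hs.scalar i).exists_smul (x ≫ g)
  have ha₀ : a ≠ 0 := by
    rintro rfl
    rw [← Category.assoc, ha] at hg
    exact hx (by simpa using hg.symm)
  exact ⟨a⁻¹ • g, by rw [Linear.comp_smul, ha, smul_smul, inv_mul_cancel₀ ha₀, one_smul]⟩

theorem isIdempotentComplete [Finite I] [HasFiniteBiproducts C] : IsIdempotentComplete C where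
  idempotents_split X e he := by
    classical
    have := Fintype.ofFinite I
    let V (i : I) : Submodule k (s i ⟶ X) := LinearMap.range (Linear.rightComp k (s i) e)
    have mem_V {i} (x : V i) : x.1 ≫ e = x := by
      obtain ⟨_, y, rfl⟩ := x
      simp [he]
    have (i : I) : Module.Finite k (s i ⟶ X) := hs.finite_hom _ _
    let b (i : I) := Module.finBasis k (V i)
    let T (t : Σ i, Fin (Module.finrank k (V i))) : C := s t.1
    let ι (i a) : s i ⟶ ⨁ T := biproduct.ι T ⟨i, a⟩
    obtain ⟨p, hp⟩ := hs.exists_hom (X := X) (Y := ⨁ T) fun i =>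
      (b i).constr k (ι i) ∘ₗ (Linear.rightComp k (s i) e).rangeRestrict
    have basis_comp (i a) : (b i a).1 ≫ p = ι i a := by
      rw [hp, ← (b i).constr_basis k (ι i) a, LinearMap.comp_apply]
      exact congrArg _ (Subtype.ext (mem_V _))
    let desc : ⨁ T ⟶ X := biproduct.desc fun t => (b t.1 t.2).1
    have ι_desc (i a) : ι i a ≫ desc = (b i a).1 := biproduct.ι_desc _ _
    have constr_desc (i) (x : V i) : (b i).constr k (ι i) x ≫ desc = x.1 :=
      LinearMap.congr_fun (f := Linear.rightComp k (s i) desc ∘ₗ (b i).constr k (ι i))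
        (g := (V i).subtype) ((b i).ext fun a => by simp [ι_desc]) x
    refine ⟨⨁ T, desc, p, ?_, ?_⟩
    · refine biproduct.hom_ext' _ _ fun ⟨i, a⟩ => ?_
      rw [← Category.assoc, ι_desc i a, basis_comp, Category.comp_id]
    · refine hs.hom_ext_of_comp_left fun i x => ?_
      rw [← Category.assoc, hp]
      exact constr_desc i _

theorem isAbelian [Finite I] [HasFiniteBiproducts C] : IsAbelian C :=
  have := hs.isIdempotentComplete
  hs.isVonNeumannRegular.isAbelian

end IsCompleteScalarFamily

section Fusion

variable (k : Type w) [CommRing k] (C : Type u) [Category.{v} C] [MonoidalCategory C]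
  [Preadditive C] [Linear k C] [FusionCategory k C]

/-- The finite type of isomorphism classes of scalar objects of a fusion category. -/
abbrev ScalarClass : Type u :=
  (FusionCategory.finite_scalarClasses (k := k) (C := C)).toFinset

variable {C} in
/-- A representative of an isomorphism class of scalar objects; these are the representatives
over which `fusionDim` sums. -/
noncomputable def scalarRep (q : ScalarClass k C) : C := q.1.out

variable {k C}

theorem exists_iso_scalarRep {X : C} (hX : IsScalar k X) :
    ∃ q : ScalarClass k C, Nonempty (X ≅ scalarRep k q) := by
  refine ⟨⟨Quotient.mk (isIsomorphicSetoid C) X, (Set.Finite.mem_toFinset _).2 ⟨X, hX, rfl⟩⟩, ?_⟩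
  exact Quotient.exact (Quotient.out_eq (Quotient.mk (isIsomorphicSetoid C) X)).symm

theorem isScalar_scalarRep (q : ScalarClass k C) : IsScalar k (scalarRep k q) := by
  obtain ⟨X, hX, hq⟩ := (Set.Finite.mem_toFinset _).1 q.2
  have h : Nonempty (X ≅ q.1.out) := Quotient.exact (hq.trans (Quotient.out_eq q.1).symm)
  exact hX.of_iso h.some

variable (k C) in
theorem isCompleteScalarFamily_scalarRep :
    IsCompleteScalarFamily k (scalarRep k : ScalarClass k C → C) where
  scalar := isScalar_scalarRep
  hom_eq_zero q r hqr := by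
    refine FusionCategory.hom_eq_zero (k := k) _ _ (isScalar_scalarRep q) (isScalar_scalarRep r)
      fun h => hqr (Subtype.ext ?_)
    rw [← Quotient.out_eq q.1, ← Quotient.out_eq r.1]
    exact Quotient.sound h
  complete X := by
    have := FusionCategory.hasFiniteBiproducts (k := k) (C := C)
    obtain ⟨n, S, hS, ⟨e⟩⟩ := FusionCategory.exists_iso_biproduct (k := k) X
    choose q hq using fun a => exists_iso_scalarRep (hS a)
    refine ⟨n, q, fun a => e.hom ≫ biproduct.π S a ≫ (hq a).some.hom,
      fun a => (hq a).some.inv ≫ biproduct.ι S a ≫ e.inv, ?_⟩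
    calc _ = e.hom ≫ (∑ a, biproduct.π S a ≫ biproduct.ι S a) ≫ e.inv := by
          simp [Preadditive.sum_comp, Preadditive.comp_sum, -biproduct.total]
      _ = 𝟙 X := by rw [biproduct.total]; simp

end Fusion

/-! ### Limits and colimits in the center -/

section JointlyMonic

variable {C : Type u} [Category.{v} C] [MonoidalCategory C] {J : Type*}

/-- A half braiding on `A` obtained from a family of morphisms from `A` to objects of the center
that remains jointly monic after tensoring. -/
def halfBraidingOfJointlyMonic {A : C} {X : J → C} (b : ∀ j, HalfBraiding (X j))
    (β : ∀ U, A ⊗ U ≅ U ⊗ A) (p : ∀ j, A ⟶ X j)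
    (hβ : ∀ U j, (β U).hom ≫ U ◁ p j = p j ▷ U ≫ ((b j).β U).hom)
    (hp : ∀ {Z U : C} {f g : Z ⟶ U ⊗ A}, (∀ j, f ≫ U ◁ p j = g ≫ U ◁ p j) → f = g) :
    HalfBraiding A where
  β := β
  monoidal U V := hp fun j => by
    have hβV : U ◁ (β V).hom ≫ U ◁ V ◁ p j = U ◁ p j ▷ V ≫ U ◁ ((b j).β V).hom := by
      simp only [← MonoidalCategory.whiskerLeft_comp, hβ]
    have hβU : (β U).hom ▷ V ≫ (U ◁ p j) ▷ V = p j ▷ U ▷ V ≫ ((b j).β U).hom ▷ V := by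
      simp only [← comp_whiskerRight, hβ]
    simp only [hβ, (b j).monoidal, Category.assoc, whiskerRight_tensor, Iso.hom_inv_id_assoc,
      ← associator_inv_naturality_right, reassoc_of% hβV]
    rw [← associator_naturality_middle_assoc, reassoc_of% hβU]
  naturality {U V} f := hp fun j => by
    rw [Category.assoc, hβ, whisker_exchange_assoc, (b j).naturality, Category.assoc,
      ← whisker_exchange, ← Category.assoc, ← hβ, Category.assoc]

theorem comm_of_jointlyMonic {B : J → Center C} {A Z : Center C} (p : ∀ j, A ⟶ B j) {U : C}
    (hp : ∀ {f g : Z.1 ⊗ U ⟶ U ⊗ A.1}, (∀ j, f ≫ U ◁ (p j).f = g ≫ U ◁ (p j).f) → f = g)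
    {f : Z.1 ⟶ A.1} (g : ∀ j, Z ⟶ B j) (hg : ∀ j, f ≫ (p j).f = (g j).f) :
    f ▷ U ≫ (A.2.β U).hom = (Z.2.β U).hom ≫ U ◁ f :=
  hp fun j => by
    rw [Category.assoc, ← (p j).comm, ← comp_whiskerRight_assoc, hg, (g j).comm, Category.assoc,
      ← MonoidalCategory.whiskerLeft_comp, hg]

end JointlyMonic

section JointlyEpic

variable {C : Type u} [Category.{v} C] [MonoidalCategory C] {J : Type*}

/-- A half braiding on `A` obtained from a family of morphisms to `A` from objects of the center
that remains jointly epic after tensoring. -/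
def halfBraidingOfJointlyEpic {A : C} {X : J → C} (b : ∀ j, HalfBraiding (X j))
    (β : ∀ U, A ⊗ U ≅ U ⊗ A) (q : ∀ j, X j ⟶ A)
    (hβ : ∀ U j, q j ▷ U ≫ (β U).hom = ((b j).β U).hom ≫ U ◁ q j)
    (hq : ∀ {Z U : C} {f g : A ⊗ U ⟶ Z}, (∀ j, q j ▷ U ≫ f = q j ▷ U ≫ g) → f = g) :
    HalfBraiding A where
  β := β
  monoidal U V := hq fun j => by
    have hβV : U ◁ q j ▷ V ≫ U ◁ (β V).hom = U ◁ ((b j).β V).hom ≫ U ◁ V ◁ q j := by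
      simp only [← MonoidalCategory.whiskerLeft_comp, hβ]
    have hβU : q j ▷ U ▷ V ≫ (β U).hom ▷ V = ((b j).β U).hom ▷ V ≫ (U ◁ q j) ▷ V := by
      simp only [← comp_whiskerRight, hβ]
    rw [hβ, (b j).monoidal]
    simp only [Category.assoc, whiskerRight_tensor, Iso.hom_inv_id_assoc, reassoc_of% hβU,
      associator_naturality_middle_assoc, reassoc_of% hβV, ← associator_inv_naturality_right]
  naturality {U V} f := hq fun j => by
    rw [← whisker_exchange_assoc, hβ, (b j).naturality_assoc, ← whisker_exchange,
      ← Category.assoc, ← hβ, Category.assoc]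

theorem comm_of_jointlyEpic {B : J → Center C} {A Z : Center C} (q : ∀ j, B j ⟶ A) {U : C}
    (hq : ∀ {f g : A.1 ⊗ U ⟶ U ⊗ Z.1}, (∀ j, (q j).f ▷ U ≫ f = (q j).f ▷ U ≫ g) → f = g)
    {f : A.1 ⟶ Z.1} (g : ∀ j, B j ⟶ Z) (hg : ∀ j, (q j).f ≫ f = (g j).f) :
    f ▷ U ≫ (Z.2.β U).hom = (A.2.β U).hom ≫ U ◁ f :=
  hq fun j => by
    rw [← comp_whiskerRight_assoc, hg, (g j).comm, ← Category.assoc, (q j).comm, Category.assoc,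
      ← MonoidalCategory.whiskerLeft_comp, hg]

end JointlyEpic

section CenterLimits

variable {C : Type u} [Category.{v} C] [MonoidalCategory C] {J : Type*} [Category* J]
  (K : J ⥤ Center C)

/-- The half braidings of a diagram in the center as a natural isomorphism. -/
def halfBraidingNatIso (U : C) :
    (K ⋙ Center.forget C) ⋙ tensorRight U ≅ (K ⋙ Center.forget C) ⋙ tensorLeft U :=
  NatIso.ofComponents (fun j => (K.obj j).2.β U) fun f => (K.map f).comm U

section Limit

variable [∀ U : C, PreservesLimit (K ⋙ Center.forget C) (tensorLeft U)]
  {c : Cone (K ⋙ Center.forget C)} (hc : IsLimit c)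

include hc in
theorem whiskerLeft_hom_ext_of_isLimit {Z U : C} {f g : Z ⟶ U ⊗ c.pt}
    (h : ∀ j, f ≫ U ◁ c.π.app j = g ≫ U ◁ c.π.app j) : f = g :=
  (isLimitOfPreserves (tensorLeft U) hc).hom_ext h

variable [∀ U : C, PreservesLimit (K ⋙ Center.forget C) (tensorRight U)]

/-- The isomorphism underlying the half braiding of the limit of a diagram in the center. -/
noncomputable def limitHalfBraidingIso (U : C) : c.pt ⊗ U ≅ U ⊗ c.pt :=
  (isLimitOfPreserves (tensorRight U) hc).conePointsIsoOfNatIso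
    (isLimitOfPreserves (tensorLeft U) hc) (halfBraidingNatIso K U)

theorem limitHalfBraidingIso_hom_comp (U : C) (j : J) :
    (limitHalfBraidingIso K hc U).hom ≫ U ◁ c.π.app j =
      c.π.app j ▷ U ≫ ((K.obj j).2.β U).hom :=
  IsLimit.conePointsIsoOfNatIso_hom_comp _ _ _ _

/-- The half braiding of the limit of a diagram in the center. -/
noncomputable def limitHalfBraiding : HalfBraiding c.pt :=
  halfBraidingOfJointlyMonic (fun j => (K.obj j).2) (limitHalfBraidingIso K hc)
    (fun j => c.π.app j) (limitHalfBraidingIso_hom_comp K hc)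
    (whiskerLeft_hom_ext_of_isLimit K hc)

/-- The limit cone in the center of a diagram whose underlying limit is preserved by tensoring. -/
noncomputable def centerLimitCone : Cone K where
  pt := ⟨c.pt, limitHalfBraiding K hc⟩
  π :=
    { app j := ⟨c.π.app j, fun U => (limitHalfBraidingIso_hom_comp K hc U j).symm⟩
      naturality _ _ f := Center.ext _ _ (c.π.naturality f) }

/-- The cone `centerLimitCone` is universal, with the same lifts as in the underlying category. -/
noncomputable def isLimitCenterLimitCone : IsLimit (centerLimitCone K hc) where
  lift t :=
    { f := hc.lift ((Center.forget C).mapCone t)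
      comm _ := comm_of_jointlyMonic (centerLimitCone K hc).π.app
        (whiskerLeft_hom_ext_of_isLimit K hc) t.π.app fun j => hc.fac _ j }
  fac _ j := Center.ext _ _ (hc.fac _ j)
  uniq t m h := Center.ext _ _ (hc.uniq ((Center.forget C).mapCone t) m.f fun j =>
    congrArg Center.Hom.f (h j))

noncomputable instance : CreatesLimit K (Center.forget C) :=
  createsLimitOfReflectsIso fun _ hc =>
    { liftedCone := centerLimitCone K hc
      validLift := Iso.refl _
      makesLimit := isLimitCenterLimitCone K hc }

end Limit

section Colimit

variable [∀ U : C, PreservesColimit (K ⋙ Center.forget C) (tensorRight U)]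
  {c : Cocone (K ⋙ Center.forget C)} (hc : IsColimit c)

include hc in
theorem whiskerRight_hom_ext_of_isColimit {Z U : C} {f g : c.pt ⊗ U ⟶ Z}
    (h : ∀ j, c.ι.app j ▷ U ≫ f = c.ι.app j ▷ U ≫ g) : f = g :=
  (isColimitOfPreserves (tensorRight U) hc).hom_ext h

variable [∀ U : C, PreservesColimit (K ⋙ Center.forget C) (tensorLeft U)]

/-- The isomorphism underlying the half braiding of the colimit of a diagram in the center. -/
noncomputable def colimitHalfBraidingIso (U : C) : c.pt ⊗ U ≅ U ⊗ c.pt :=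
  (isColimitOfPreserves (tensorRight U) hc).coconePointsIsoOfNatIso
    (isColimitOfPreserves (tensorLeft U) hc) (halfBraidingNatIso K U)

theorem comp_colimitHalfBraidingIso_hom (U : C) (j : J) :
    c.ι.app j ▷ U ≫ (colimitHalfBraidingIso K hc U).hom =
      ((K.obj j).2.β U).hom ≫ U ◁ c.ι.app j :=
  IsColimit.comp_coconePointsIsoOfNatIso_hom (isColimitOfPreserves (tensorRight U) hc)
    (isColimitOfPreserves (tensorLeft U) hc) (halfBraidingNatIso K U) j

/-- The half braiding of the colimit of a diagram in the center. -/
noncomputable def colimitHalfBraiding : HalfBraiding c.pt :=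
  halfBraidingOfJointlyEpic (fun j => (K.obj j).2) (colimitHalfBraidingIso K hc)
    (fun j => c.ι.app j) (comp_colimitHalfBraidingIso_hom K hc)
    (whiskerRight_hom_ext_of_isColimit K hc)

/-- The colimit cocone in the center of a diagram whose underlying colimit is preserved by
tensoring. -/
noncomputable def centerColimitCocone : Cocone K where
  pt := ⟨c.pt, colimitHalfBraiding K hc⟩
  ι :=
    { app j := ⟨c.ι.app j, fun U => comp_colimitHalfBraidingIso_hom K hc U j⟩
      naturality _ _ f := Center.ext _ _ (c.ι.naturality f) }

/-- The cocone `centerColimitCocone` is universal, with the same descents as in the underlying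
category. -/
noncomputable def isColimitCenterColimitCocone : IsColimit (centerColimitCocone K hc) where
  desc t :=
    { f := hc.desc ((Center.forget C).mapCocone t)
      comm _ := comm_of_jointlyEpic (centerColimitCocone K hc).ι.app
        (whiskerRight_hom_ext_of_isColimit K hc) t.ι.app fun j => hc.fac _ j }
  fac _ j := Center.ext _ _ (hc.fac _ j)
  uniq t m h := Center.ext _ _ (hc.uniq ((Center.forget C).mapCocone t) m.f fun j =>
    congrArg Center.Hom.f (h j))

noncomputable instance : CreatesColimit K (Center.forget C) :=
  createsColimitOfReflectsIso fun _ hc =>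
    { liftedCocone := centerColimitCocone K hc
      validLift := Iso.refl _
      makesColimit := isColimitCenterColimitCocone K hc }

end Colimit

section Rigid

variable [RigidCategory C]

universe w₁ w₂

instance (U : C) : PreservesLimitsOfSize.{w₁, w₂} (tensorLeft U) :=
  (tensorLeftAdjunction U Uᘁ).rightAdjoint_preservesLimits

instance (U : C) : PreservesLimitsOfSize.{w₁, w₂} (tensorRight U) :=
  (tensorRightAdjunction (ᘁU) U).rightAdjoint_preservesLimits

instance (U : C) : PreservesColimitsOfSize.{w₁, w₂} (tensorLeft U) :=
  (tensorLeftAdjunction (ᘁU) U).leftAdjoint_preservesColimits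

instance (U : C) : PreservesColimitsOfSize.{w₁, w₂} (tensorRight U) :=
  (tensorRightAdjunction U Uᘁ).leftAdjoint_preservesColimits

noncomputable instance : CreatesLimitsOfShape J (Center.forget C) where

end Rigid

theorem center_hasFiniteProducts {C : Type u} [Category.{v} C] [MonoidalCategory C]
    [RigidCategory C] [HasFiniteProducts C] : HasFiniteProducts (Center C) :=
  ⟨fun _ => hasLimitsOfShape_of_hasLimitsOfShape_createsLimitsOfShape (Center.forget C)⟩

end CenterLimits

section CenterPreadditive

variable {C : Type u} [Category.{v} C] [MonoidalCategory C] [Preadditive C] [MonoidalPreadditive C]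

instance : (Center.forget C).Additive where

theorem center_sum_f {X Y : Center C} {J : Type*} (S : Finset J) (g : J → (X ⟶ Y)) :
    (∑ j ∈ S, g j).f = ∑ j ∈ S, (g j).f :=
  (Center.forget C).map_sum (f := g) (s := S)

theorem center_hasFiniteBiproducts [RigidCategory C] [HasFiniteBiproducts C] :
    HasFiniteBiproducts (Center C) :=
  have := center_hasFiniteProducts (C := C)
  HasFiniteBiproducts.of_hasFiniteProducts

end CenterPreadditive

section CenterAbelian

variable {C : Type u} [Category.{v} C] [MonoidalCategory C] [P : Preadditive C]
  [MonoidalPreadditive C] [RigidCategory C]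

theorem center_isAbelian (hC : IsAbelian C) : IsAbelian (Center C) := by
  obtain ⟨A, rfl⟩ := hC
  have := center_hasFiniteProducts (C := C)
  have : HasKernels (Center C) := ⟨fun _ => hasLimit_of_created _ (Center.forget C)⟩
  have : HasCokernels (Center C) := ⟨fun _ => hasColimit_of_created _ (Center.forget C)⟩
  have {X Y : Center C} (f : X ⟶ Y) : IsIso (Abelian.coimageImageComparison f) := by
    have : IsIso ((Center.forget C).map (Abelian.coimageImageComparison f)) :=
      ((MorphismProperty.isomorphisms C).arrow_mk_iso_iff
        (Abelian.PreservesCoimageImageComparison.iso (Center.forget C) f)).2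
        (inferInstanceAs (IsIso _))
    exact isIso_of_reflects_iso _ (Center.forget C)
  exact ⟨Abelian.ofCoimageImageComparisonIsIso, rfl⟩

end CenterAbelian

/-! ### Rigidity of the center -/

section HalfBraiding

variable {C : Type u} [Category.{v} C] [MonoidalCategory C] {A : C} (σ : HalfBraiding A)

theorem halfBraiding_unit_hom : (σ.β (𝟙_ C)).hom = (ρ_ A).hom ≫ (λ_ A).inv :=
  let A' : Center C := ⟨A, σ⟩
  (congrArg Center.Hom.f (braiding_tensorUnit_right A')).trans
    (congrArg ((ρ_ A).hom ≫ ·) (Center.leftUnitor_inv_f A'))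

theorem halfBraiding_unit_inv : (σ.β (𝟙_ C)).inv = (λ_ A).hom ≫ (ρ_ A).inv := by
  rw [← cancel_epi (σ.β (𝟙_ C)).hom, Iso.hom_inv_id, halfBraiding_unit_hom]
  simp

theorem halfBraiding_tensor_inv (U V : C) :
    (σ.β (U ⊗ V)).inv = (α_ _ _ _).hom ≫ U ◁ (σ.β V).inv ≫ (α_ _ _ _).inv ≫
      (σ.β U).inv ▷ V ≫ (α_ _ _ _).hom := by
  rw [← cancel_epi (σ.β (U ⊗ V)).hom, Iso.hom_inv_id, σ.monoidal]
  simp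

theorem halfBraiding_inv_naturality {U V : C} (f : U ⟶ V) :
    f ▷ A ≫ (σ.β V).inv = (σ.β U).inv ≫ A ◁ f := by
  rw [Iso.comp_inv_eq, Category.assoc, σ.naturality, Iso.inv_hom_id_assoc]

theorem halfBraiding_inv_comp_whiskerRight {A B : Center C} (f : A ⟶ B) (U : C) :
    (A.2.β U).inv ≫ f.f ▷ U = U ◁ f.f ≫ (B.2.β U).inv := by
  rw [Iso.inv_comp_eq, ← Category.assoc, Iso.eq_comp_inv, f.comm]

end HalfBraiding

section LaxHalfBraiding

variable {C : Type u} [Category.{v} C] [MonoidalCategory C]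

/-- A half braiding on `A` whose components are not required to be invertible. Then the
compatibility with the unit object has to be demanded separately. -/
structure LaxHalfBraiding (A : C) where
  θ (X : C) : A ⊗ X ⟶ X ⊗ A
  unit : θ (𝟙_ C) = (ρ_ A).hom ≫ (λ_ A).inv
  tensor (U V : C) : θ (U ⊗ V) =
    (α_ _ _ _).inv ≫ θ U ▷ V ≫ (α_ _ _ _).hom ≫ U ◁ θ V ≫ (α_ _ _ _).inv
  naturality {U V : C} (f : U ⟶ V) : A ◁ f ≫ θ V = θ U ≫ f ▷ A

namespace LaxHalfBraiding

variable [LeftRigidCategory C] {A : C} (σ : LaxHalfBraiding A)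

/-- The inverse of the component at `X` of a lax half braiding: the mate of the component at the
left dual of `X`. -/
def inv (X : C) : X ⊗ A ⟶ A ⊗ X :=
  𝟙 _ ⊗≫ (X ⊗ A) ◁ η_ (ᘁX) X ⊗≫ X ◁ σ.θ (ᘁX) ▷ X ⊗≫ ε_ (ᘁX) X ▷ (A ⊗ X) ⊗≫ 𝟙 _

theorem θ_comp_inv (X : C) : σ.θ X ≫ σ.inv X = 𝟙 _ :=
  calc
    _ = 𝟙 _ ⊗≫ (σ.θ X ▷ 𝟙_ C ≫ (X ⊗ A) ◁ η_ (ᘁX) X) ⊗≫ X ◁ σ.θ (ᘁX) ▷ X ⊗≫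
        ε_ (ᘁX) X ▷ (A ⊗ X) ⊗≫ 𝟙 _ := by rw [inv]; monoidal
    _ = 𝟙 _ ⊗≫ (A ⊗ X) ◁ η_ (ᘁX) X ⊗≫ ((α_ _ _ _).inv ≫ σ.θ X ▷ (ᘁX) ≫ (α_ _ _ _).hom ≫
        X ◁ σ.θ (ᘁX) ≫ (α_ _ _ _).inv) ▷ X ⊗≫ ε_ (ᘁX) X ▷ (A ⊗ X) ⊗≫ 𝟙 _ := by
      rw [← whisker_exchange]; monoidal
    _ = 𝟙 _ ⊗≫ (A ⊗ X) ◁ η_ (ᘁX) X ⊗≫ (σ.θ (X ⊗ ᘁX) ≫ ε_ (ᘁX) X ▷ A) ▷ X ⊗≫ 𝟙 _ := by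
      rw [← σ.tensor]; monoidal
    _ = 𝟙 _ ⊗≫ A ◁ (X ◁ η_ (ᘁX) X ⊗≫ ε_ (ᘁX) X ▷ X) ⊗≫ σ.θ (𝟙_ C) ▷ X ⊗≫ 𝟙 _ := by
      rw [← σ.naturality]; monoidal
    _ = _ := by
      rw [ExactPairing.coevaluation_evaluation'', σ.unit]; monoidal

theorem inv_comp_θ (X : C) : σ.inv X ≫ σ.θ X = 𝟙 _ :=
  calc
    _ = 𝟙 _ ⊗≫ (X ⊗ A) ◁ η_ (ᘁX) X ⊗≫ X ◁ σ.θ (ᘁX) ▷ X ⊗≫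
        (ε_ (ᘁX) X ▷ (A ⊗ X) ≫ 𝟙_ C ◁ σ.θ X) ⊗≫ 𝟙 _ := by rw [inv]; monoidal
    _ = 𝟙 _ ⊗≫ (X ⊗ A) ◁ η_ (ᘁX) X ⊗≫ X ◁ ((α_ _ _ _).inv ≫ σ.θ (ᘁX) ▷ X ≫ (α_ _ _ _).hom ≫
        (ᘁX) ◁ σ.θ X ≫ (α_ _ _ _).inv) ⊗≫ ε_ (ᘁX) X ▷ (X ⊗ A) ⊗≫ 𝟙 _ := by
      rw [← whisker_exchange]; monoidal
    _ = 𝟙 _ ⊗≫ X ◁ (A ◁ η_ (ᘁX) X ≫ σ.θ ((ᘁX) ⊗ X)) ⊗≫ ε_ (ᘁX) X ▷ (X ⊗ A) ⊗≫ 𝟙 _ := by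
      rw [← σ.tensor]; monoidal
    _ = 𝟙 _ ⊗≫ X ◁ σ.θ (𝟙_ C) ⊗≫ (X ◁ η_ (ᘁX) X ⊗≫ ε_ (ᘁX) X ▷ X) ▷ A ⊗≫ 𝟙 _ := by
      rw [σ.naturality]; monoidal
    _ = _ := by
      rw [ExactPairing.coevaluation_evaluation'', σ.unit]; monoidal

/-- In the presence of left duals every lax half braiding is a half braiding. -/
def toHalfBraiding : HalfBraiding A where
  β X := ⟨σ.θ X, σ.inv X, σ.θ_comp_inv X, σ.inv_comp_θ X⟩
  monoidal := σ.tensor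
  naturality := σ.naturality

end LaxHalfBraiding

end LaxHalfBraiding

section DualBraiding

variable {C : Type u} [Category.{v} C] [MonoidalCategory C]
variable {A B : C} [ExactPairing A B] (σ : HalfBraiding A)

variable (B) in
/-- The components of the half braiding on a right dual of `A` induced by a half braiding
on `A`. -/
def dualBraiding (X : C) : B ⊗ X ⟶ X ⊗ B :=
  𝟙 _ ⊗≫ (B ⊗ X) ◁ η_ A B ⊗≫ B ◁ (σ.β X).inv ▷ B ⊗≫ ε_ A B ▷ (X ⊗ B) ⊗≫ 𝟙 _

theorem coevaluation_dualBraiding (Y : C) :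
    η_ A B ▷ Y ⊗≫ A ◁ dualBraiding B σ Y = 𝟙 _ ⊗≫ Y ◁ η_ A B ⊗≫ (σ.β Y).inv ▷ B ⊗≫ 𝟙 _ :=
  calc
    _ = 𝟙 _ ⊗≫ (η_ A B ▷ (Y ⊗ 𝟙_ C) ≫ (A ⊗ B) ◁ (Y ◁ η_ A B)) ⊗≫ A ◁ B ◁ (σ.β Y).inv ▷ B ⊗≫
        A ◁ ε_ A B ▷ (Y ⊗ B) ⊗≫ 𝟙 _ := by
      rw [dualBraiding]; monoidal
    _ = 𝟙 _ ⊗≫ Y ◁ η_ A B ⊗≫ (η_ A B ▷ ((Y ⊗ A) ⊗ B) ≫ (A ⊗ B) ◁ ((σ.β Y).inv ▷ B)) ⊗≫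
        A ◁ ε_ A B ▷ (Y ⊗ B) ⊗≫ 𝟙 _ := by
      rw [← whisker_exchange]; monoidal
    _ = 𝟙 _ ⊗≫ Y ◁ η_ A B ⊗≫ (σ.β Y).inv ▷ B ⊗≫ (η_ A B ▷ A ⊗≫ A ◁ ε_ A B) ▷ (Y ⊗ B) ⊗≫ 𝟙 _ := by
      rw [← whisker_exchange]; monoidal
    _ = _ := by
      rw [ExactPairing.evaluation_coevaluation'']; monoidal

theorem dualBraiding_evaluation (Y : C) :
    dualBraiding B σ Y ▷ A ⊗≫ Y ◁ ε_ A B = 𝟙 _ ⊗≫ B ◁ (σ.β Y).inv ⊗≫ ε_ A B ▷ Y ⊗≫ 𝟙 _ :=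
  calc
    _ = 𝟙 _ ⊗≫ (B ⊗ Y) ◁ η_ A B ▷ A ⊗≫ B ◁ (σ.β Y).inv ▷ (B ⊗ A) ⊗≫
        (ε_ A B ▷ (Y ⊗ (B ⊗ A)) ≫ 𝟙_ C ◁ (Y ◁ ε_ A B)) ⊗≫ 𝟙 _ := by
      rw [dualBraiding]; monoidal
    _ = 𝟙 _ ⊗≫ (B ⊗ Y) ◁ η_ A B ▷ A ⊗≫ B ◁ ((σ.β Y).inv ▷ (B ⊗ A) ≫ (A ⊗ Y) ◁ ε_ A B) ⊗≫
        ε_ A B ▷ Y ⊗≫ 𝟙 _ := by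
      rw [← whisker_exchange]; monoidal
    _ = 𝟙 _ ⊗≫ (B ⊗ Y) ◁ (η_ A B ▷ A ⊗≫ A ◁ ε_ A B) ⊗≫ B ◁ (σ.β Y).inv ⊗≫
        ε_ A B ▷ Y ⊗≫ 𝟙 _ := by
      rw [← whisker_exchange]; monoidal
    _ = _ := by
      rw [ExactPairing.evaluation_coevaluation'']; monoidal

theorem dualBraiding_unit : dualBraiding B σ (𝟙_ C) = (ρ_ B).hom ≫ (λ_ B).inv :=
  calc
    _ = 𝟙 _ ⊗≫ (B ◁ η_ A B ⊗≫ ε_ A B ▷ B) ⊗≫ 𝟙 _ := by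
      rw [dualBraiding, halfBraiding_unit_inv]; monoidal
    _ = _ := by
      rw [ExactPairing.coevaluation_evaluation'']; monoidal

theorem dualBraiding_naturality {U V : C} (f : U ⟶ V) :
    B ◁ f ≫ dualBraiding B σ V = dualBraiding B σ U ≫ f ▷ B :=
  calc
    _ = 𝟙 _ ⊗≫ B ◁ (f ▷ 𝟙_ C ≫ V ◁ η_ A B) ⊗≫ B ◁ (σ.β V).inv ▷ B ⊗≫ ε_ A B ▷ (V ⊗ B) ⊗≫ 𝟙 _ := by
      rw [dualBraiding]; monoidal
    _ = 𝟙 _ ⊗≫ (B ⊗ U) ◁ η_ A B ⊗≫ B ◁ (f ▷ A ≫ (σ.β V).inv) ▷ B ⊗≫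
        ε_ A B ▷ (V ⊗ B) ⊗≫ 𝟙 _ := by
      rw [← whisker_exchange]; monoidal
    _ = 𝟙 _ ⊗≫ (B ⊗ U) ◁ η_ A B ⊗≫ B ◁ (σ.β U).inv ▷ B ⊗≫
        ((B ⊗ A) ◁ (f ▷ B) ≫ ε_ A B ▷ (V ⊗ B)) ⊗≫ 𝟙 _ := by
      rw [halfBraiding_inv_naturality]; monoidal
    _ = _ := by
      rw [whisker_exchange, dualBraiding]; monoidal

theorem dualBraiding_tensor (U V : C) : dualBraiding B σ (U ⊗ V) =
    (α_ _ _ _).inv ≫ dualBraiding B σ U ▷ V ≫ (α_ _ _ _).hom ≫ U ◁ dualBraiding B σ V ≫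
      (α_ _ _ _).inv := by
  symm
  calc
    _ = 𝟙 _ ⊗≫ (B ⊗ U) ◁ η_ A B ▷ V ⊗≫ B ◁ (σ.β U).inv ▷ B ▷ V ⊗≫
        (ε_ A B ▷ (U ⊗ (B ⊗ V)) ≫ 𝟙_ C ◁ (U ◁ dualBraiding B σ V)) ⊗≫ 𝟙 _ := by
      conv_lhs => rw [dualBraiding]
      monoidal
    _ = 𝟙 _ ⊗≫ (B ⊗ U) ◁ η_ A B ▷ V ⊗≫ B ◁ ((σ.β U).inv ▷ (B ⊗ V) ≫
        (A ⊗ U) ◁ dualBraiding B σ V) ⊗≫ ε_ A B ▷ (U ⊗ (V ⊗ B)) ⊗≫ 𝟙 _ := by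
      rw [← whisker_exchange]; monoidal
    _ = 𝟙 _ ⊗≫ (B ⊗ U) ◁ (η_ A B ▷ V ⊗≫ A ◁ dualBraiding B σ V) ⊗≫ B ◁ (σ.β U).inv ▷ (V ⊗ B) ⊗≫
        ε_ A B ▷ (U ⊗ (V ⊗ B)) ⊗≫ 𝟙 _ := by
      rw [← whisker_exchange]; monoidal
    _ = _ := by
      rw [coevaluation_dualBraiding, dualBraiding, halfBraiding_tensor_inv]; monoidal

variable (B) in
/-- The half braiding on a right dual of `A` induced by a half braiding on `A`. -/
def dualHalfBraiding [LeftRigidCategory C] : HalfBraiding B :=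
  LaxHalfBraiding.toHalfBraiding ⟨dualBraiding B σ, dualBraiding_unit σ, dualBraiding_tensor σ,
    dualBraiding_naturality σ⟩

end DualBraiding

section CenterRigid

variable {C : Type u} [Category.{v} C] [MonoidalCategory C] [LeftRigidCategory C]

/-- A right dual in `C` of an object of the center, with the induced half braiding. -/
def centerDual (A : Center C) (B : C) [ExactPairing A.1 B] : Center C :=
  ⟨B, dualHalfBraiding B A.2⟩

theorem center_coevaluation_comm (A : Center C) (B : C) [ExactPairing A.1 B] (U : C) :
    η_ A.1 B ▷ U ≫ ((A ⊗ centerDual A B).2.β U).hom =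
      ((𝟙_ (Center C)).2.β U).hom ≫ U ◁ η_ A.1 B := by
  change η_ A.1 B ▷ U ≫ (α_ _ _ _).hom ≫ A.1 ◁ dualBraiding B A.2 U ≫ (α_ _ _ _).inv ≫
    (A.2.β U).hom ▷ B ≫ (α_ _ _ _).hom = ((λ_ U).hom ≫ (ρ_ U).inv) ≫ U ◁ η_ A.1 B
  calc
    _ = 𝟙 _ ⊗≫ (η_ A.1 B ▷ U ⊗≫ A.1 ◁ dualBraiding B A.2 U) ⊗≫
        (A.2.β U).hom ▷ B ⊗≫ 𝟙 _ := by monoidal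
    _ = 𝟙 _ ⊗≫ U ◁ η_ A.1 B ⊗≫ ((A.2.β U).inv ≫ (A.2.β U).hom) ▷ B ⊗≫ 𝟙 _ := by
      rw [coevaluation_dualBraiding]; monoidal
    _ = _ := by rw [Iso.inv_hom_id]; monoidal

theorem center_evaluation_comm (A : Center C) (B : C) [ExactPairing A.1 B] (U : C) :
    ε_ A.1 B ▷ U ≫ ((𝟙_ (Center C)).2.β U).hom =
      ((centerDual A B ⊗ A).2.β U).hom ≫ U ◁ ε_ A.1 B := by
  change ε_ A.1 B ▷ U ≫ (λ_ U).hom ≫ (ρ_ U).inv = ((α_ _ _ _).hom ≫ B ◁ (A.2.β U).hom ≫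
    (α_ _ _ _).inv ≫ dualBraiding B A.2 U ▷ A.1 ≫ (α_ _ _ _).hom) ≫ U ◁ ε_ A.1 B
  symm
  calc
    _ = 𝟙 _ ⊗≫ B ◁ (A.2.β U).hom ⊗≫ (dualBraiding B A.2 U ▷ A.1 ⊗≫
        U ◁ ε_ A.1 B) ⊗≫ 𝟙 _ := by monoidal
    _ = 𝟙 _ ⊗≫ B ◁ ((A.2.β U).hom ≫ (A.2.β U).inv) ⊗≫ ε_ A.1 B ▷ U ⊗≫ 𝟙 _ := by
      rw [dualBraiding_evaluation]; monoidal
    _ = _ := by rw [Iso.hom_inv_id]; monoidal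

instance (A : Center C) (B : C) [ExactPairing A.1 B] : ExactPairing A (centerDual A B) where
  coevaluation' := ⟨η_ A.1 B, center_coevaluation_comm A B⟩
  evaluation' := ⟨ε_ A.1 B, center_evaluation_comm A B⟩
  coevaluation_evaluation' := Center.ext _ _ (by
    simp only [Center.comp_f, Center.whiskerLeft_f, Center.whiskerRight_f,
      Center.associator_inv_f, Center.rightUnitor_hom_f, Center.leftUnitor_inv_f]
    exact ExactPairing.coevaluation_evaluation A.1 B)
  evaluation_coevaluation' := Center.ext _ _ (by
    simp only [Center.comp_f, Center.whiskerLeft_f, Center.whiskerRight_f,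
      Center.associator_hom_f, Center.leftUnitor_hom_f, Center.rightUnitor_inv_f]
    exact ExactPairing.evaluation_coevaluation A.1 B)

instance [RightRigidCategory C] : RightRigidCategory (Center C) where
  rightDual A := ⟨centerDual A (A.1)ᘁ⟩

end CenterRigid

/-! ### Cofree objects of the center -/

section Cofree

variable {C : Type u} [Category.{v} C] [MonoidalCategory C]

/-- A natural family `u V : R ⊗ V ⟶ V ⊗ X` is cofree if it is universal among the natural families
`Y ⊗ V ⟶ V ⊗ X`, that is, if `R` is the end of the `(V ⊗ X) ⊗ Vᘁ`. It makes `R` the underlying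
object of the cofree object of the center on `X`. -/
structure IsCofree {X R : C} (u : ∀ V, R ⊗ V ⟶ V ⊗ X) : Prop where
  naturality {V V' : C} (f : V ⟶ V') : R ◁ f ≫ u V' = u V ≫ f ▷ X
  exists_lift {Y : C} (φ : ∀ V, Y ⊗ V ⟶ V ⊗ X)
    (hφ : ∀ {V V' : C} (f : V ⟶ V'), Y ◁ f ≫ φ V' = φ V ≫ f ▷ X) :
    ∃ a : Y ⟶ R, ∀ V, a ▷ V ≫ u V = φ V
  hom_ext {Y : C} {a b : Y ⟶ R} (h : ∀ V, a ▷ V ≫ u V = b ▷ V ≫ u V) : a = b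

theorem IsCompleteScalarFamily.exists_isCofree {k : Type w} [CommRing k] [Preadditive C]
    [Linear k C] [MonoidalPreadditive C] [MonoidalLinear k C] [HasFiniteBiproducts C]
    [RightRigidCategory C] {I : Type*} [Finite I] {s : I → C} (hs : IsCompleteScalarFamily k s)
    (X : C) : ∃ (R : C) (u : ∀ V, R ⊗ V ⟶ V ⊗ X), IsCofree u := by
  let F (i : I) : C := (s i ⊗ X) ⊗ (s i)ᘁ
  let mate (Y : C) (i : I) := tensorRightHomEquiv Y (s i) (s i)ᘁ (s i ⊗ X)
  obtain ⟨u, hu⟩ := hs.exists_natTrans (tensorLeft (⨁ F)) (tensorRight X)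
    fun i => (mate _ i).symm (biproduct.π F i)
  have whiskerRight_comp_u {Y} (a : Y ⟶ ⨁ F) (i) :
      a ▷ s i ≫ u.app (s i) = (mate Y i).symm (a ≫ biproduct.π F i) := by
    rw [hu, tensorRightHomEquiv_symm_naturality]
  refine ⟨⨁ F, u.app, fun f => u.naturality f, fun {Y} φ hφ => ?_, fun {Y a b} h => ?_⟩
  · let a : Y ⟶ ⨁ F := biproduct.lift fun i => mate Y i (φ (s i))
    let φ' : tensorLeft Y ⟶ tensorRight X := ⟨φ, fun _ _ f => hφ f⟩
    have map_a_comp_u : (tensoringLeft C).map a ≫ u = φ' := hs.natTrans_ext fun i => by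
      change a ▷ s i ≫ u.app (s i) = φ (s i)
      rw [whiskerRight_comp_u, biproduct.lift_π, Equiv.symm_apply_apply]
    exact ⟨a, fun V => congrArg (fun t => t.app V) map_a_comp_u⟩
  · refine biproduct.hom_ext _ _ fun i => (mate Y i).symm.injective ?_
    rw [← whiskerRight_comp_u, ← whiskerRight_comp_u, h]

namespace IsCofree

variable {X R : C} {u : ∀ V, R ⊗ V ⟶ V ⊗ X}

theorem whiskerRight_tensorLeftHomEquiv_symm {Y W W' : C} [ExactPairing W W'] (a : Y ⟶ W ⊗ R)
    (V : C) : (tensorLeftHomEquiv Y W W' R).symm a ▷ V ≫ u V = (α_ _ _ _).hom ≫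
      (tensorLeftHomEquiv (Y ⊗ V) W W' (V ⊗ X)).symm (a ▷ V ≫ (α_ _ _ _).hom ≫ W ◁ u V) := by
  simp only [tensorLeftHomEquiv]
  dsimp
  calc
    _ = 𝟙 _ ⊗≫ W' ◁ a ▷ V ⊗≫ (ε_ W W' ▷ (R ⊗ V) ≫ 𝟙_ C ◁ u V) ⊗≫ 𝟙 _ := by monoidal
    _ = _ := by rw [← whisker_exchange]; monoidal

variable (hu : IsCofree u)
include hu

theorem tensor_hom_ext {Y W W' : C} [ExactPairing W W'] {a b : Y ⟶ W ⊗ R}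
    (h : ∀ V, a ▷ V ≫ (α_ _ _ _).hom ≫ W ◁ u V = b ▷ V ≫ (α_ _ _ _).hom ≫ W ◁ u V) : a = b := by
  refine (tensorLeftHomEquiv Y W W' R).symm.injective (hu.hom_ext fun V => ?_)
  rw [whiskerRight_tensorLeftHomEquiv_symm, whiskerRight_tensorLeftHomEquiv_symm, h]

theorem exists_tensor_lift {Y W W' : C} [ExactPairing W W'] (φ : ∀ V, Y ⊗ V ⟶ W ⊗ (V ⊗ X))
    (hφ : ∀ {V V' : C} (f : V ⟶ V'), Y ◁ f ≫ φ V' = φ V ≫ W ◁ f ▷ X) :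
    ∃ a : Y ⟶ W ⊗ R, ∀ V, a ▷ V ≫ (α_ _ _ _).hom ≫ W ◁ u V = φ V := by
  let mate (V : C) := tensorLeftHomEquiv (Y ⊗ V) W W' (V ⊗ X)
  obtain ⟨a, ha⟩ := hu.exists_lift (fun V => (α_ _ _ _).hom ≫ (mate V).symm (φ V)) fun f => by
    rw [associator_naturality_right_assoc, ← tensorLeftHomEquiv_symm_naturality, hφ, Category.assoc]
    congr 1
    rw [Equiv.symm_apply_eq, tensorLeftHomEquiv_naturality, Equiv.apply_symm_apply]
  refine ⟨tensorLeftHomEquiv Y W W' R a, fun V => (mate V).symm.injective ?_⟩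
  rw [← cancel_epi (α_ W' Y V).hom, ← ha, ← whiskerRight_tensorLeftHomEquiv_symm,
    Equiv.symm_apply_apply]

variable [RigidCategory C]

theorem exists_braiding (W : C) : ∃ a : R ⊗ W ⟶ W ⊗ R, ∀ V, a ▷ V ≫ (α_ W R V).hom ≫ W ◁ u V =
    (α_ _ _ _).hom ≫ u (W ⊗ V) ≫ (α_ W V X).hom :=
  hu.exists_tensor_lift (W' := Wᘁ) (fun V => (α_ R W V).hom ≫ u (W ⊗ V) ≫ (α_ W V X).hom)
    fun f => by simp [reassoc_of% hu.naturality (W ◁ f)]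

/-- The components of the half braiding of a cofree object, obtained from its universal
property. -/
noncomputable def braiding (W : C) : R ⊗ W ⟶ W ⊗ R := (hu.exists_braiding W).choose

theorem braiding_spec (W V : C) : hu.braiding W ▷ V ≫ (α_ W R V).hom ≫ W ◁ u V =
    (α_ _ _ _).hom ≫ u (W ⊗ V) ≫ (α_ W V X).hom :=
  (hu.exists_braiding W).choose_spec V

theorem braiding_unit : hu.braiding (𝟙_ C) = (ρ_ R).hom ≫ (λ_ R).inv := by
  refine hu.tensor_hom_ext (W' := 𝟙_ C) fun V => ?_
  have h : u (𝟙_ C ⊗ V) = R ◁ (λ_ V).hom ≫ u V ≫ (λ_ V).inv ▷ X := by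
    rw [reassoc_of% hu.naturality (λ_ V).hom]
    simp
  rw [hu.braiding_spec]
  simp [h]

theorem braiding_naturality {W W' : C} (f : W ⟶ W') :
    R ◁ f ≫ hu.braiding W' = hu.braiding W ≫ f ▷ R := by
  refine hu.tensor_hom_ext (W' := W'ᘁ) fun V => ?_
  calc
    _ = (R ◁ f) ▷ V ≫ (hu.braiding W' ▷ V ≫ (α_ W' R V).hom ≫ W' ◁ u V) := by simp
    _ = (α_ _ _ _).hom ≫ (R ◁ (f ▷ V) ≫ u (W' ⊗ V)) ≫ (α_ W' V X).hom := by
      rw [hu.braiding_spec]; simp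
    _ = (hu.braiding W ▷ V ≫ (α_ W R V).hom ≫ W ◁ u V) ≫ f ▷ (V ⊗ X) := by
      rw [hu.naturality, hu.braiding_spec]; simp
    _ = _ := by rw [Category.assoc, Category.assoc, whisker_exchange]; simp

theorem braiding_tensor (W W' : C) : hu.braiding (W ⊗ W') =
    (α_ _ _ _).inv ≫ hu.braiding W ▷ W' ≫ (α_ _ _ _).hom ≫ W ◁ hu.braiding W' ≫
      (α_ _ _ _).inv := by
  refine hu.tensor_hom_ext (W' := (W ⊗ W')ᘁ) fun V => ?_
  rw [hu.braiding_spec]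
  symm
  calc
    _ = (α_ _ _ _).inv ▷ V ≫ hu.braiding W ▷ W' ▷ V ≫ 𝟙 _ ⊗≫
        W ◁ (hu.braiding W' ▷ V ≫ (α_ W' R V).hom ≫ W' ◁ u V) ⊗≫ 𝟙 _ := by monoidal
    _ = 𝟙 _ ⊗≫ (hu.braiding W ▷ (W' ⊗ V) ≫ (α_ _ _ _).hom ≫ W ◁ u (W' ⊗ V)) ⊗≫ 𝟙 _ := by
      rw [hu.braiding_spec]; monoidal
    _ = 𝟙 _ ⊗≫ (u (W ⊗ W' ⊗ V) ≫ (α_ _ _ _).inv ▷ X) ⊗≫ 𝟙 _ := by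
      rw [hu.braiding_spec]; monoidal
    _ = _ := by
      rw [← hu.naturality]; monoidal

/-- A cofree object, as an object of the center. -/
noncomputable def center : Center C :=
  ⟨R, LaxHalfBraiding.toHalfBraiding
    ⟨hu.braiding, hu.braiding_unit, hu.braiding_tensor, hu.braiding_naturality⟩⟩

theorem exists_center_lift (A : Center C) (g : A.1 ⟶ X) :
    ∃ a : A ⟶ hu.center, ∀ V, a.f ▷ V ≫ u V = (A.2.β V).hom ≫ V ◁ g := by
  obtain ⟨a, ha⟩ := hu.exists_lift (fun V => (A.2.β V).hom ≫ V ◁ g) fun {V V'} f => by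
    rw [HalfBraiding.naturality_assoc, Category.assoc, whisker_exchange]
  refine ⟨⟨a, fun U => ?_⟩, ha⟩
  change a ▷ U ≫ hu.braiding U = (A.2.β U).hom ≫ U ◁ a
  refine hu.tensor_hom_ext (W' := Uᘁ) fun V => ?_
  calc
    _ = a ▷ U ▷ V ≫ (hu.braiding U ▷ V ≫ (α_ _ _ _).hom ≫ U ◁ u V) := by simp
    _ = (α_ _ _ _).hom ≫ (a ▷ (U ⊗ V) ≫ u (U ⊗ V)) ≫ (α_ _ _ _).hom := by
      rw [hu.braiding_spec]; simp
    _ = (A.2.β U).hom ▷ V ≫ (α_ _ _ _).hom ≫ U ◁ (a ▷ V ≫ u V) := by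
      rw [ha, ha]; simp
    _ = _ := by simp

theorem center_lift_ne_zero [Preadditive C] [MonoidalPreadditive C] {A : Center C} {g : A.1 ⟶ X}
    (hg : g ≠ 0) {a : A ⟶ hu.center} (ha : ∀ V, a.f ▷ V ≫ u V = (A.2.β V).hom ≫ V ◁ g) :
    a ≠ 0 := by
  rintro rfl
  have h : 0 ▷ 𝟙_ C ≫ u (𝟙_ C) = (A.2.β (𝟙_ C)).hom ≫ 𝟙_ C ◁ g := ha (𝟙_ C)
  rw [MonoidalPreadditive.zero_whiskerRight, zero_comp, eq_comm,
    Preadditive.IsIso.comp_left_eq_zero] at h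
  refine hg ?_
  rw [← cancel_epi (λ_ A.1).hom, ← leftUnitor_naturality, h, zero_comp, comp_zero]

end IsCofree

end Cofree

/-! ### Loops and the dimension -/

theorem IsScalar.isIso_of_retraction {k : Type w} [Field k] {C : Type u} [Category.{v} C]
    [Preadditive C] [Linear k C] {X Y : C} (hX : IsScalar k X) {f : Y ⟶ X} {g : X ⟶ Y}
    (hfg : f ≫ g = 𝟙 Y) (hf : f ≠ 0) : IsIso f := by
  obtain ⟨c, hc⟩ := hX.exists_smul (g ≫ f)
  have hcf : c • f = (1 : k) • f :=
    calc c • f = f ≫ g ≫ f := by simp [hc]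
      _ = (1 : k) • f := by simp [reassoc_of% hfg]
  obtain rfl : c = 1 := smul_left_injective k hf hcf
  exact ⟨g, hfg, by simp [hc]⟩

theorem IsCompleteScalarFamily.exists_iso {k : Type w} [Field k] {C : Type u} [Category.{v} C]
    [Preadditive C] [Linear k C] {I : Type*} {s : I → C} (hs : IsCompleteScalarFamily k s)
    {X : C} (hX : IsScalar k X) : ∃ i, Nonempty (X ≅ s i) := by
  obtain ⟨i, x, hx⟩ := hs.exists_comp_ne_zero hX.id_ne_zero
  rw [Category.comp_id] at hx
  obtain ⟨y, hy⟩ := hs.exists_retraction x hx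
  have := hX.isIso_of_retraction hy hx
  exact ⟨i, ⟨(asIso x).symm⟩⟩

section IsotypicProjection

variable {k : Type w} [CommRing k] {C : Type u} [Category.{v} C] [Preadditive C] [Linear k C]
  {I : Type*} {s : I → C} (hs : IsCompleteScalarFamily k s)

namespace IsCompleteScalarFamily

include hs in
theorem exists_isotypicProjection (i : I) :
    ∃ p : 𝟭 C ⟶ 𝟭 C, p.app (s i) = 𝟙 (s i) ∧ ∀ j, j ≠ i → p.app (s j) = 0 := by
  classical
  obtain ⟨p, hp⟩ := hs.exists_natTrans (𝟭 C) (𝟭 C) (fun j => if j = i then 𝟙 _ else 0)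
  exact ⟨p, by simpa using hp i, fun j hj => by simpa [hj] using hp j⟩

/-- The natural projection of every object onto its isotypic component of type `s i`. -/
noncomputable def isotypicProjection (i : I) : 𝟭 C ⟶ 𝟭 C := (hs.exists_isotypicProjection i).choose

theorem isotypicProjection_app_self (i : I) : (hs.isotypicProjection i).app (s i) = 𝟙 (s i) :=
  (hs.exists_isotypicProjection i).choose_spec.1

theorem isotypicProjection_app_of_ne {i j : I} (hij : j ≠ i) :
    (hs.isotypicProjection i).app (s j) = 0 :=
  (hs.exists_isotypicProjection i).choose_spec.2 j hij

theorem sum_isotypicProjection [Fintype I] : ∑ i, hs.isotypicProjection i = 𝟙 (𝟭 C) :=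
  hs.natTrans_ext fun j => by
    rw [NatTrans.app_sum, Finset.sum_eq_single j
      (fun i _ hij => hs.isotypicProjection_app_of_ne hij.symm) (by simp),
      isotypicProjection_app_self]
    rfl

theorem isotypicProjection_app_eq_zero {X V : C} {i : I} (e : X ≅ s i) (hV : ∀ z : X ⟶ V, z = 0) :
    (hs.isotypicProjection i).app V = 0 := by
  refine hs.hom_ext_of_comp_left fun j z => ?_
  have naturality : z ≫ (hs.isotypicProjection i).app V =
      (hs.isotypicProjection i).app (s j) ≫ z := (hs.isotypicProjection i).naturality z
  rw [naturality]
  obtain rfl | hji := eq_or_ne j i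
  · obtain rfl : z = 0 := by simpa using congrArg (e.inv ≫ ·) (hV (e.hom ≫ z))
    simp
  · simp [hs.isotypicProjection_app_of_ne hji]

theorem smul_isotypicProjection_app {X V : C} {i : I} (e : X ≅ s i) {y : X ⟶ V} {x : V ⟶ X} {d : k}
    (hyx : y ≫ x = d • 𝟙 X) (hy : ∀ z : X ⟶ V, ∃ c : k, z = c • y) :
    d • (hs.isotypicProjection i).app V = x ≫ y := by
  refine hs.hom_ext_of_comp_left fun j z => ?_
  have naturality : z ≫ (hs.isotypicProjection i).app V =
      (hs.isotypicProjection i).app (s j) ≫ z := (hs.isotypicProjection i).naturality z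
  rw [Linear.comp_smul, naturality]
  obtain rfl | hji := eq_or_ne j i
  · obtain ⟨c, hc⟩ := hy (e.hom ≫ z)
    obtain rfl : z = c • e.inv ≫ y := by simpa using congrArg (e.inv ≫ ·) hc
    simp [isotypicProjection_app_self, reassoc_of% hyx, smul_smul, mul_comm c d]
  · have hzx : z ≫ x = 0 := by
      simpa using congrArg (· ≫ e.inv) (hs.hom_eq_zero j i hji (z ≫ x ≫ e.hom))
    simp [hs.isotypicProjection_app_of_ne hji, reassoc_of% hzx]

end IsCompleteScalarFamily

end IsotypicProjection

section TwoSidedDuals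

/-- A right rigid category in which the right dual of every object is also a left dual of it. Unlike
in a pivotal category, the two pairings of `X` and `Xᘁ` are not related to each other. -/
class TwoSidedDuals (C : Type u) [Category.{v} C] [MonoidalCategory C] [RightRigidCategory C] where
  exactPairing (X : C) : ExactPairing Xᘁ X

instance {C : Type u} [Category.{v} C] [MonoidalCategory C] [PivotalCategory C] :
    RightRigidCategory C where
  rightDual X :=
    { rightDual := PivotalCategory.dual X
      exact := PivotalCategory.leftPairing X }

instance {C : Type u} [Category.{v} C] [MonoidalCategory C] [PivotalCategory C] :
    TwoSidedDuals C where
  exactPairing := PivotalCategory.rightPairing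

variable {C : Type u} [Category.{v} C] [MonoidalCategory C] [RightRigidCategory C]
  [TwoSidedDuals C]

instance (X : C) : ExactPairing Xᘁ X := TwoSidedDuals.exactPairing X

instance : RigidCategory C where
  leftDual X := { leftDual := Xᘁ }

/-- The closed loop coloured by an object that is its left dimension in a pivotal category. -/
def leftLoop (X : C) : 𝟙_ C ⟶ 𝟙_ C := η_ Xᘁ X ≫ ε_ X Xᘁ

/-- The closed loop coloured by an object that is its right dimension in a pivotal category. -/
def rightLoop (X : C) : 𝟙_ C ⟶ 𝟙_ C := η_ X Xᘁ ≫ ε_ Xᘁ X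

theorem exists_eq_coevaluation_comp {W V : C} (g : 𝟙_ C ⟶ Wᘁ ⊗ V) :
    ∃ f : W ⟶ V, g = η_ Wᘁ W ≫ Wᘁ ◁ f := by
  let mate := tensorLeftHomEquiv (𝟙_ C) Wᘁ W V
  refine ⟨(ρ_ W).inv ≫ mate.symm g, mate.symm.injective ?_⟩
  change _ = mate.symm (η_ Wᘁ W ≫ Wᘁ ◁ _)
  rw [tensorLeftHomEquiv_symm_coevaluation_comp_whiskerLeft, Iso.hom_inv_id_assoc]

/-- The partial trace over `W` of an endomorphism of `Wᘁ ⊗ V`. -/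
def closeDual (W : C) {V : C} (f : Wᘁ ⊗ V ⟶ Wᘁ ⊗ V) : V ⟶ V :=
  𝟙 _ ⊗≫ η_ W Wᘁ ▷ V ⊗≫ W ◁ f ⊗≫ ε_ Wᘁ W ▷ V ⊗≫ 𝟙 _

theorem closeDual_naturality (W : C) {V V' : C} (f : V ⟶ V') {g : Wᘁ ⊗ V ⟶ Wᘁ ⊗ V}
    {g' : Wᘁ ⊗ V' ⟶ Wᘁ ⊗ V'} (h : Wᘁ ◁ f ≫ g' = g ≫ Wᘁ ◁ f) :
    f ≫ closeDual W g' = closeDual W g ≫ f := by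
  calc
    _ = 𝟙 _ ⊗≫ (𝟙_ C ◁ f ≫ η_ W Wᘁ ▷ V') ⊗≫ W ◁ g' ⊗≫ ε_ Wᘁ W ▷ V' ⊗≫ 𝟙 _ := by
      rw [closeDual]; monoidal
    _ = 𝟙 _ ⊗≫ η_ W Wᘁ ▷ V ⊗≫ W ◁ (Wᘁ ◁ f ≫ g') ⊗≫ ε_ Wᘁ W ▷ V' ⊗≫ 𝟙 _ := by
      rw [whisker_exchange]; monoidal
    _ = 𝟙 _ ⊗≫ η_ W Wᘁ ▷ V ⊗≫ W ◁ g ⊗≫ ((W ⊗ Wᘁ) ◁ f ≫ ε_ Wᘁ W ▷ V') ⊗≫ 𝟙 _ := by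
      rw [h]; monoidal
    _ = _ := by
      rw [whisker_exchange, closeDual]; monoidal

theorem closeDual_evaluation_comp_coevaluation (W : C) : closeDual W (ε_ W Wᘁ ≫ η_ Wᘁ W) = 𝟙 W := by
  calc
    _ = 𝟙 _ ⊗≫ (η_ W Wᘁ ▷ W ⊗≫ W ◁ ε_ W Wᘁ) ⊗≫ (W ◁ η_ Wᘁ W ⊗≫ ε_ Wᘁ W ▷ W) ⊗≫ 𝟙 _ := by
      rw [closeDual]; monoidal
    _ = _ := by
      rw [ExactPairing.evaluation_coevaluation'', ExactPairing.coevaluation_evaluation'']; monoidal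

/-- The natural endomorphism encircling a strand by `W`, with `φ` applied to the two strands. -/
def encircle (W : C) (φ : 𝟭 C ⟶ 𝟭 C) : 𝟭 C ⟶ 𝟭 C where
  app V := closeDual W (φ.app (Wᘁ ⊗ V))
  naturality _ _ f := closeDual_naturality W f (φ.naturality (Wᘁ ◁ f))

end TwoSidedDuals

section Loops

variable {k : Type w} [CommRing k] {C : Type u} [Category.{v} C] [MonoidalCategory C]
  [Preadditive C] [Linear k C] [MonoidalPreadditive C] [MonoidalLinear k C]

namespace IsCofree

variable {R : C} {u : ∀ V, R ⊗ V ⟶ V ⊗ 𝟙_ C} (hu : IsCofree u)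

omit [Preadditive C] [MonoidalPreadditive C] in
include hu in
theorem exists_ofNatTrans (φ : 𝟭 C ⟶ 𝟭 C) :
    ∃ a : 𝟙_ C ⟶ R, ∀ V, a ▷ V ≫ u V = (λ_ V).hom ≫ φ.app V ≫ (ρ_ V).inv :=
  hu.exists_lift (fun V => (λ_ V).hom ≫ φ.app V ≫ (ρ_ V).inv) fun {V V'} f => by
    have naturality : f ≫ φ.app V' = φ.app V ≫ f := φ.naturality f
    simp [reassoc_of% naturality]

variable (k) in
/-- The point of the cofree object on the unit given by a natural endomorphism of the identity
functor. -/
noncomputable def ofNatTrans : (𝟭 C ⟶ 𝟭 C) →ₗ[k] (𝟙_ C ⟶ R) where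
  toFun φ := (hu.exists_ofNatTrans φ).choose
  map_add' φ ψ := hu.hom_ext fun V => by
    rw [(hu.exists_ofNatTrans (φ + ψ)).choose_spec]
    simp [MonoidalPreadditive.add_whiskerRight, (hu.exists_ofNatTrans _).choose_spec]
  map_smul' c φ := hu.hom_ext fun V => by
    rw [(hu.exists_ofNatTrans (c • φ)).choose_spec]
    simp [MonoidalLinear.smul_whiskerRight, (hu.exists_ofNatTrans _).choose_spec]

theorem ofNatTrans_spec (φ : 𝟭 C ⟶ 𝟭 C) (V : C) :
    hu.ofNatTrans k φ ▷ V ≫ u V = (λ_ V).hom ≫ φ.app V ≫ (ρ_ V).inv :=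
  (hu.exists_ofNatTrans φ).choose_spec V

variable [RightRigidCategory C] [TwoSidedDuals C]

theorem ofNatTrans_encircle (W : C) (φ : 𝟭 C ⟶ 𝟭 C) :
    hu.ofNatTrans k (encircle W φ) = η_ W Wᘁ ⊗≫
      W ◁ (hu.ofNatTrans k φ ▷ Wᘁ ≫ hu.braiding Wᘁ) ⊗≫ ε_ Wᘁ W ▷ R ⊗≫ 𝟙 _ := by
  have spec := hu.ofNatTrans_spec (k := k) φ
  refine hu.hom_ext fun V => Eq.symm ?_
  generalize hu.ofNatTrans k φ = a at spec
  calc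
    _ = 𝟙 _ ⊗≫ η_ W Wᘁ ▷ V ⊗≫ W ◁ (a ▷ Wᘁ ≫ hu.braiding Wᘁ) ▷ V ⊗≫
        (ε_ Wᘁ W ▷ (R ⊗ V) ≫ 𝟙_ C ◁ u V) ⊗≫ 𝟙 _ := by monoidal
    _ = 𝟙 _ ⊗≫ η_ W Wᘁ ▷ V ⊗≫ W ◁ a ▷ Wᘁ ▷ V ⊗≫ W ◁ (hu.braiding Wᘁ ▷ V ≫
        (α_ _ _ _).hom ≫ Wᘁ ◁ u V) ⊗≫ ε_ Wᘁ W ▷ V ⊗≫ 𝟙 _ := by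
      rw [← whisker_exchange]; monoidal
    _ = 𝟙 _ ⊗≫ η_ W Wᘁ ▷ V ⊗≫ W ◁ (a ▷ (Wᘁ ⊗ V) ≫ u (Wᘁ ⊗ V)) ⊗≫
        ε_ Wᘁ W ▷ V ⊗≫ 𝟙 _ := by
      rw [hu.braiding_spec]; monoidal
    _ = (λ_ V).hom ≫ closeDual W (φ.app (Wᘁ ⊗ V)) ≫ (ρ_ V).inv := by
      rw [spec, closeDual]; dsimp only [Functor.id_obj]; monoidal
    _ = _ := (hu.ofNatTrans_spec (encircle W φ) V).symm

theorem ofNatTrans_encircle_comp (W : C) {φ : 𝟭 C ⟶ 𝟭 C} {r : R ⟶ 𝟙_ C}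
    (hr : ∀ V, r ▷ V ≫ (λ_ V).hom ≫ (ρ_ V).inv = hu.braiding V ≫ V ◁ r) {c : k}
    (hc : hu.ofNatTrans k φ ≫ r = c • 𝟙 _) :
    hu.ofNatTrans k (encircle W φ) ≫ r = c • rightLoop W := by
  rw [hu.ofNatTrans_encircle]
  generalize hu.ofNatTrans k φ = a at hc
  calc
    _ = 𝟙 _ ⊗≫ η_ W Wᘁ ⊗≫ W ◁ (a ▷ Wᘁ ≫ hu.braiding Wᘁ) ⊗≫
        (ε_ Wᘁ W ▷ R ≫ 𝟙_ C ◁ r) ⊗≫ 𝟙 _ := by monoidal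
    _ = 𝟙 _ ⊗≫ η_ W Wᘁ ⊗≫ W ◁ (a ▷ Wᘁ ≫ hu.braiding Wᘁ ≫ Wᘁ ◁ r) ⊗≫
        ε_ Wᘁ W ⊗≫ 𝟙 _ := by
      rw [← whisker_exchange]; monoidal
    _ = 𝟙 _ ⊗≫ η_ W Wᘁ ⊗≫ W ◁ ((a ≫ r) ▷ Wᘁ ≫ (λ_ _).hom ≫ (ρ_ _).inv) ⊗≫
        ε_ Wᘁ W ⊗≫ 𝟙 _ := by
      rw [← hr]; monoidal
    _ = c • (𝟙 _ ⊗≫ η_ W Wᘁ ⊗≫ W ◁ ((𝟙 _) ▷ Wᘁ ≫ (λ_ _).hom ≫ (ρ_ _).inv) ⊗≫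
        ε_ Wᘁ W ⊗≫ 𝟙 _) := by
      rw [hc]
      simp [monoidalComp]
    _ = _ := by
      rw [rightLoop]
      congr 1
      monoidal

end IsCofree

namespace IsCompleteScalarFamily

variable [RightRigidCategory C] [TwoSidedDuals C] {I : Type*} {s : I → C}
  (hs : IsCompleteScalarFamily k s)

omit [MonoidalLinear k C] in
theorem encircle_isotypicProjection_app_of_ne {o : I} (e : 𝟙_ C ≅ s o) {i j : I} (hij : j ≠ i) :
    (encircle (s i) (hs.isotypicProjection o)).app (s j) = 0 := by
  have hom_eq_zero (g : 𝟙_ C ⟶ (s i)ᘁ ⊗ s j) : g = 0 := by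
    obtain ⟨f, rfl⟩ := exists_eq_coevaluation_comp g
    simp [hs.hom_eq_zero i j hij.symm f]
  have h := hs.isotypicProjection_app_eq_zero e hom_eq_zero
  simp [encircle, h, closeDual, monoidalComp]

theorem leftLoop_smul_encircle_isotypicProjection (h1 : IsScalar k (𝟙_ C)) {o : I}
    (e : 𝟙_ C ≅ s o) (i : I) :
    h1.coeff (leftLoop (s i)) • encircle (s i) (hs.isotypicProjection o) =
      hs.isotypicProjection i := by
  have coevaluation_comp_evaluation :
      η_ (s i)ᘁ (s i) ≫ ε_ (s i) (s i)ᘁ = h1.coeff (leftLoop (s i)) • 𝟙 _ := by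
    simp [h1.coeff_smul_id, leftLoop]
  have hom_eq_smul (z : 𝟙_ C ⟶ (s i)ᘁ ⊗ s i) : ∃ c : k, z = c • η_ (s i)ᘁ (s i) := by
    obtain ⟨f, rfl⟩ := exists_eq_coevaluation_comp z
    obtain ⟨c, rfl⟩ := (hs.scalar i).exists_smul f
    exact ⟨c, by simp⟩
  have smul_app := hs.smul_isotypicProjection_app e coevaluation_comp_evaluation hom_eq_smul
  refine hs.natTrans_ext fun j => ?_
  rw [NatTrans.app_smul]
  obtain rfl | hji := eq_or_ne j i
  · rw [hs.isotypicProjection_app_self, ← closeDual_evaluation_comp_coevaluation, ← smul_app]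
    simp [encircle, closeDual, monoidalComp]
  · rw [hs.encircle_isotypicProjection_app_of_ne e hji, hs.isotypicProjection_app_of_ne hji,
      smul_zero]

end IsCompleteScalarFamily

end Loops

theorem IsCompleteScalarFamily.sum_loop_ne_zero {k : Type w} [Field k] {C : Type u}
    [Category.{v} C] [MonoidalCategory C] [Preadditive C] [Linear k C] [MonoidalPreadditive C]
    [MonoidalLinear k C] [RightRigidCategory C] [TwoSidedDuals C] {I : Type*} [Fintype I]
    {s : I → C} (hs : IsCompleteScalarFamily k s) (h1 : IsScalar k (𝟙_ C)) {R : C}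
    {u : ∀ V, R ⊗ V ⟶ V ⊗ 𝟙_ C} (hu : IsCofree u) {r : R ⟶ 𝟙_ C}
    (hr : ∀ V, r ▷ V ≫ (λ_ V).hom ≫ (ρ_ V).inv = hu.braiding V ≫ V ◁ r)
    (hη : hu.ofNatTrans k (𝟙 (𝟭 C)) ≫ r = 𝟙 _) :
    ∑ i, h1.coeff (rightLoop (s i)) * h1.coeff (leftLoop (s i)) ≠ 0 := by
  obtain ⟨o, ⟨e⟩⟩ := hs.exists_iso h1
  obtain ⟨c, hc⟩ := h1.exists_smul (hu.ofNatTrans k (hs.isotypicProjection o) ≫ r)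
  have ofNatTrans_isotypicProjection_comp (i : I) :
      hu.ofNatTrans k (hs.isotypicProjection i) ≫ r =
        (c * (h1.coeff (rightLoop (s i)) * h1.coeff (leftLoop (s i)))) • 𝟙 _ := by
    rw [← hs.leftLoop_smul_encircle_isotypicProjection h1 e i, map_smul, Linear.smul_comp,
      hu.ofNatTrans_encircle_comp _ hr hc, ← h1.coeff_smul_id (rightLoop (s i)), smul_smul,
      smul_smul, h1.coeff_smul_id]
    ring_nf
  intro sum_eq_zero
  refine h1.id_ne_zero ?_
  rw [← hη, ← hs.sum_isotypicProjection, map_sum, Preadditive.sum_comp]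
  simp only [ofNatTrans_isotypicProjection_comp, ← Finset.sum_smul, ← Finset.mul_sum, sum_eq_zero,
    mul_zero, zero_smul]

/-! ### Averaging over half braidings -/

section RightDual

variable {C : Type u} [Category.{v} C] [MonoidalCategory C]

theorem rightAdjointMate_bijective (X Y : C) [HasRightDual X] [HasRightDual Y] :
    Function.Bijective fun f : X ⟶ Y => (fᘁ : Yᘁ ⟶ Xᘁ) := by
  let mate : (X ⟶ Y) ≃ (Yᘁ ⟶ Xᘁ) := ((λ_ X).symm.homCongr (Iso.refl Y)).trans <|
    (tensorRightHomEquiv (𝟙_ C) X Xᘁ Y).trans <|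
      (tensorLeftHomEquiv (𝟙_ C) Y Yᘁ Xᘁ).symm.trans ((ρ_ Yᘁ).homCongr (Iso.refl Xᘁ))
  convert mate.bijective with f
  have h : tensorRightHomEquiv (𝟙_ C) X Xᘁ Y ((λ_ X).hom ≫ f) = η_ X Xᘁ ≫ f ▷ Xᘁ := by
    simp [tensorRightHomEquiv, unitors_equal]
  simp [mate, Iso.homCongr, h]

variable {k : Type w} [CommRing k] [Preadditive C] [Linear k C] [MonoidalPreadditive C]
  [MonoidalLinear k C]

theorem rightAdjointMate_smul {X Y : C} [HasRightDual X] [HasRightDual Y] (c : k) (f : X ⟶ Y) :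
    (c • f)ᘁ = c • fᘁ := by
  simp [rightAdjointMate]

omit [MonoidalLinear k C] [Linear k C] in
theorem rightAdjointMate_sum {X Y : C} [HasRightDual X] [HasRightDual Y] {J : Type*} (S : Finset J)
    (f : J → (X ⟶ Y)) : (∑ a ∈ S, f a)ᘁ = ∑ a ∈ S, (f a)ᘁ := by
  simp only [rightAdjointMate, whiskerLeft_sum, sum_whiskerRight, Preadditive.sum_comp,
    Preadditive.comp_sum]

theorem IsCompleteScalarFamily.rightDual [RigidCategory C] {I : Type*} {s : I → C}
    (hs : IsCompleteScalarFamily k s) : IsCompleteScalarFamily k fun i => (s i)ᘁ where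
  scalar i := by
    have mate_smul_id :
        (fun c : k => c • 𝟙 (s i)ᘁ) = (fun f : s i ⟶ s i => fᘁ) ∘ fun c => c • 𝟙 (s i) := by
      ext c
      simp [rightAdjointMate_smul, rightAdjointMate_id]
    rw [IsScalar, mate_smul_id]
    exact (rightAdjointMate_bijective (s i) (s i)).comp (hs.scalar i)
  hom_eq_zero i j hij f := by
    obtain ⟨g, rfl⟩ := (rightAdjointMate_bijective (s j) (s i)).2 f
    rw [hs.hom_eq_zero j i hij.symm g]
    simp [rightAdjointMate]
  complete X := by
    obtain ⟨n, c, π, ι, hX⟩ := hs.complete (ᘁX)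
    let e : X ≅ (ᘁX)ᘁ := rightDualIso (X := ᘁX) inferInstance inferInstance
    refine ⟨n, c, fun a => e.hom ≫ (ι a)ᘁ, fun a => (π a)ᘁ ≫ e.inv, ?_⟩
    calc
      _ = e.hom ≫ (∑ a, π a ≫ ι a)ᘁ ≫ e.inv := by
        simp only [rightAdjointMate_sum, comp_rightAdjointMate, Preadditive.sum_comp,
          Preadditive.comp_sum, Category.assoc]
      _ = 𝟙 X := by
        rw [hX, rightAdjointMate_id, Category.id_comp, e.hom_inv_id]

end RightDual

section Bend

variable {C : Type u} [Category.{v} C] [MonoidalCategory C] [RightRigidCategory C]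
  {U V W Y A : C}

/-- A morphism `W ⊗ U ⟶ V`, with the strands `U` and `V` bent through the left pairings. -/
def bendIn (f : W ⊗ U ⟶ V) : Vᘁ ⊗ W ⟶ Uᘁ :=
  𝟙 _ ⊗≫ (Vᘁ ⊗ W) ◁ η_ U Uᘁ ⊗≫ Vᘁ ◁ f ▷ Uᘁ ⊗≫ ε_ V Vᘁ ▷ Uᘁ ⊗≫ 𝟙 _

theorem bendIn_comp_evaluation (f : W ⊗ U ⟶ V) :
    bendIn f ▷ U ≫ ε_ U Uᘁ = (α_ Vᘁ W U).hom ≫ Vᘁ ◁ f ≫ ε_ V Vᘁ := by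
  calc
    _ = 𝟙 ((Vᘁ ⊗ W : C) ⊗ U) ⊗≫ (Vᘁ ⊗ W) ◁ η_ U Uᘁ ▷ U ⊗≫ Vᘁ ◁ f ▷ (Uᘁ ⊗ U) ⊗≫
        (ε_ V Vᘁ ▷ (Uᘁ ⊗ U) ≫ 𝟙_ C ◁ ε_ U Uᘁ) ⊗≫ 𝟙 _ := by
      rw [bendIn]; monoidal
    _ = 𝟙 ((Vᘁ ⊗ W : C) ⊗ U) ⊗≫ (Vᘁ ⊗ W) ◁ η_ U Uᘁ ▷ U ⊗≫ Vᘁ ◁ (f ▷ (Uᘁ ⊗ U) ≫ V ◁ ε_ U Uᘁ) ⊗≫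
        ε_ V Vᘁ ⊗≫ 𝟙 _ := by
      rw [← whisker_exchange]; monoidal
    _ = 𝟙 ((Vᘁ ⊗ W : C) ⊗ U) ⊗≫ (Vᘁ ⊗ W) ◁ (η_ U Uᘁ ▷ U ⊗≫ U ◁ ε_ U Uᘁ) ⊗≫
        Vᘁ ◁ f ⊗≫ ε_ V Vᘁ ⊗≫ 𝟙 _ := by
      rw [← whisker_exchange]; monoidal
    _ = _ := by
      rw [ExactPairing.evaluation_coevaluation'']; monoidal

theorem coevaluation_comp_bendIn (f : W ⊗ U ⟶ V) :
    η_ V Vᘁ ▷ W ⊗≫ V ◁ bendIn f = 𝟙 _ ⊗≫ W ◁ η_ U Uᘁ ⊗≫ f ▷ Uᘁ ⊗≫ 𝟙 _ := by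
  calc
    _ = 𝟙 _ ⊗≫ (η_ V Vᘁ ▷ (W ⊗ 𝟙_ C) ≫ (V ⊗ Vᘁ) ◁ (W ◁ η_ U Uᘁ)) ⊗≫
        (V ⊗ Vᘁ) ◁ f ▷ Uᘁ ⊗≫ V ◁ ε_ V Vᘁ ▷ Uᘁ ⊗≫ 𝟙 _ := by
      rw [bendIn]; monoidal
    _ = 𝟙 _ ⊗≫ W ◁ η_ U Uᘁ ⊗≫ (η_ V Vᘁ ▷ (W ⊗ U) ≫ (V ⊗ Vᘁ) ◁ f) ▷ Uᘁ ⊗≫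
        V ◁ ε_ V Vᘁ ▷ Uᘁ ⊗≫ 𝟙 _ := by
      rw [← whisker_exchange]; monoidal
    _ = 𝟙 _ ⊗≫ W ◁ η_ U Uᘁ ⊗≫ f ▷ Uᘁ ⊗≫ (η_ V Vᘁ ▷ V ⊗≫ V ◁ ε_ V Vᘁ) ▷ Uᘁ ⊗≫ 𝟙 _ := by
      rw [← whisker_exchange]; monoidal
    _ = _ := by
      rw [ExactPairing.evaluation_coevaluation'']; monoidal

variable [TwoSidedDuals C]

/-- A morphism `V ⟶ W ⊗ U`, with the strands `U` and `V` bent through the right pairings. -/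
def bendOut (h : V ⟶ W ⊗ U) : Uᘁ ⟶ Vᘁ ⊗ W :=
  𝟙 _ ⊗≫ η_ Vᘁ V ▷ Uᘁ ⊗≫ Vᘁ ◁ h ▷ Uᘁ ⊗≫ (Vᘁ ⊗ W) ◁ ε_ Uᘁ U ⊗≫ 𝟙 _

theorem bendOut_surjective : Function.Surjective (bendOut (U := U) (V := V) (W := W)) := by
  let bend : (V ⟶ W ⊗ U) ≃ (Uᘁ ⟶ Vᘁ ⊗ W) :=
    (tensorRightHomEquiv V Uᘁ U W).symm.trans (tensorLeftHomEquiv Uᘁ Vᘁ V W)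
  suffices bendOut_eq : bendOut = bend from bendOut_eq ▸ bend.surjective
  ext h
  change bendOut h = (λ_ _).inv ≫ η_ Vᘁ V ▷ Uᘁ ≫ (α_ _ _ _).hom ≫
    Vᘁ ◁ (h ▷ Uᘁ ≫ (α_ _ _ _).hom ≫ W ◁ ε_ Uᘁ U ≫ (ρ_ W).hom)
  rw [bendOut]
  monoidal

theorem coevaluation_comp_bendOut (h : V ⟶ W ⊗ U) :
    η_ Uᘁ U ≫ bendOut h ▷ U = η_ Vᘁ V ≫ Vᘁ ◁ h ≫ (α_ _ _ _).inv := by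
  calc
    _ = 𝟙 _ ⊗≫ (𝟙_ C ◁ η_ Uᘁ U ≫ η_ Vᘁ V ▷ (Uᘁ ⊗ U)) ⊗≫ Vᘁ ◁ h ▷ Uᘁ ▷ U ⊗≫
        (Vᘁ ⊗ W) ◁ ε_ Uᘁ U ▷ U ⊗≫ 𝟙 _ := by
      rw [bendOut]; monoidal
    _ = 𝟙 _ ⊗≫ η_ Vᘁ V ⊗≫ Vᘁ ◁ (V ◁ η_ Uᘁ U ≫ h ▷ (Uᘁ ⊗ U)) ⊗≫
        (Vᘁ ⊗ W) ◁ ε_ Uᘁ U ▷ U ⊗≫ 𝟙 _ := by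
      rw [whisker_exchange]; monoidal
    _ = 𝟙 _ ⊗≫ η_ Vᘁ V ⊗≫ Vᘁ ◁ h ⊗≫ (Vᘁ ⊗ W) ◁ (U ◁ η_ Uᘁ U ⊗≫ ε_ Uᘁ U ▷ U) ⊗≫ 𝟙 _ := by
      rw [whisker_exchange]; monoidal
    _ = _ := by
      rw [ExactPairing.coevaluation_evaluation'']; monoidal

theorem coevaluation_comp_evaluation_eq_bendOut_comp_bendIn (h : V ⟶ W ⊗ U) (f : W ⊗ U ⟶ V) :
    η_ Vᘁ V ≫ Vᘁ ◁ (h ≫ f) ≫ ε_ V Vᘁ = η_ Uᘁ U ≫ (bendOut h ≫ bendIn f) ▷ U ≫ ε_ U Uᘁ := by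
  rw [comp_whiskerRight, Category.assoc, bendIn_comp_evaluation,
    reassoc_of% coevaluation_comp_bendOut h]
  simp

theorem bendOut_comp_evaluation (h : V ⟶ W ⊗ U) :
    V ◁ bendOut h ⊗≫ ε_ Vᘁ V ▷ W = 𝟙 _ ⊗≫ h ▷ Uᘁ ⊗≫ W ◁ ε_ Uᘁ U ⊗≫ 𝟙 _ := by
  calc
    _ = 𝟙 _ ⊗≫ V ◁ η_ Vᘁ V ▷ Uᘁ ⊗≫ (V ⊗ Vᘁ) ◁ h ▷ Uᘁ ⊗≫
        ((V ⊗ Vᘁ) ◁ (W ◁ ε_ Uᘁ U) ≫ ε_ Vᘁ V ▷ (W ⊗ 𝟙_ C)) ⊗≫ 𝟙 _ := by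
      rw [bendOut]; monoidal
    _ = 𝟙 _ ⊗≫ V ◁ η_ Vᘁ V ▷ Uᘁ ⊗≫ ((V ⊗ Vᘁ) ◁ h ≫ ε_ Vᘁ V ▷ (W ⊗ U)) ▷ Uᘁ ⊗≫
        W ◁ ε_ Uᘁ U ⊗≫ 𝟙 _ := by
      rw [whisker_exchange]; monoidal
    _ = 𝟙 _ ⊗≫ (V ◁ η_ Vᘁ V ⊗≫ ε_ Vᘁ V ▷ V) ▷ Uᘁ ⊗≫ h ▷ Uᘁ ⊗≫ W ◁ ε_ Uᘁ U ⊗≫ 𝟙 _ := by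
      rw [whisker_exchange]; monoidal
    _ = _ := by
      rw [ExactPairing.coevaluation_evaluation'']; monoidal

/-- The partial right trace over `V`. -/
def partialTrace (V : C) (f : Y ⊗ V ⟶ A ⊗ V) : Y ⟶ A :=
  𝟙 _ ⊗≫ Y ◁ η_ V Vᘁ ⊗≫ f ▷ Vᘁ ⊗≫ A ◁ ε_ Vᘁ V ⊗≫ 𝟙 _

theorem comp_partialTrace_comp {Y' A' : C} (x : Y' ⟶ Y) (f : Y ⊗ V ⟶ A ⊗ V) (y : A ⟶ A') :
    x ≫ partialTrace V f ≫ y = partialTrace V (x ▷ V ≫ f ≫ y ▷ V) := by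
  calc
    _ = 𝟙 _ ⊗≫ (x ▷ 𝟙_ C ≫ Y ◁ η_ V Vᘁ) ⊗≫ f ▷ Vᘁ ⊗≫ (A ◁ ε_ Vᘁ V ≫ y ▷ 𝟙_ C) ⊗≫ 𝟙 _ := by
      rw [partialTrace]; monoidal
    _ = _ := by
      rw [← whisker_exchange x (η_ V Vᘁ), whisker_exchange y (ε_ Vᘁ V), partialTrace]; monoidal

theorem whiskerLeft_partialTrace (U : C) (f : Y ⊗ V ⟶ A ⊗ V) :
    U ◁ partialTrace V f = partialTrace V ((α_ U Y V).hom ≫ U ◁ f ≫ (α_ U A V).inv) := by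
  simp only [partialTrace]
  monoidal

theorem partialTrace_whiskerRight (x : Y ⟶ A) :
    partialTrace V (x ▷ V) = (ρ_ Y).inv ≫ Y ◁ rightLoop V ≫ (ρ_ Y).hom ≫ x := by
  calc
    _ = 𝟙 _ ⊗≫ Y ◁ η_ V Vᘁ ⊗≫ (x ▷ (V ⊗ Vᘁ) ≫ A ◁ ε_ Vᘁ V) ⊗≫ 𝟙 _ := by
      rw [partialTrace]; monoidal
    _ = _ := by
      rw [← whisker_exchange, rightLoop]; monoidal

end Bend

section Averaging

variable {C : Type u} [Category.{v} C] [MonoidalCategory C] [RightRigidCategory C]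
  [TwoSidedDuals C] [Preadditive C] [MonoidalPreadditive C] {U V W Y A : C}

theorem partialTrace_sum {J : Type*} (S : Finset J) (f : J → (Y ⊗ V ⟶ A ⊗ V)) :
    partialTrace V (∑ a ∈ S, f a) = ∑ a ∈ S, partialTrace V (f a) := by
  simp only [partialTrace, monoidalComp, sum_whiskerRight, Preadditive.sum_comp,
    Preadditive.comp_sum]

theorem bendOut_sum {J : Type*} (S : Finset J) (h : J → (V ⟶ W ⊗ U)) :
    bendOut (∑ a ∈ S, h a) = ∑ a ∈ S, bendOut (h a) := by
  simp only [bendOut, monoidalComp, whiskerLeft_sum, sum_whiskerRight, Preadditive.sum_comp,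
    Preadditive.comp_sum]

variable {k : Type w} [CommRing k] [Linear k C] [MonoidalLinear k C]

theorem bendOut_smul (c : k) (h : V ⟶ W ⊗ U) : bendOut (c • h) = c • bendOut h := by
  simp [bendOut, monoidalComp]

variable (k) in
/-- The partial trace of `ψ` over `V`, drawn to the left of the strand `W` and with `e` applied to
the returning strand of `V` together with `W`. -/
def insertedTrace (ψ : Y ⊗ V ⟶ A ⊗ V) (W : C) :
    (Vᘁ ⊗ W ⟶ Vᘁ ⊗ W) →ₗ[k] (Y ⊗ W ⟶ A ⊗ W) where
  toFun e := 𝟙 _ ⊗≫ Y ◁ η_ V Vᘁ ▷ W ⊗≫ ψ ▷ (Vᘁ ⊗ W) ⊗≫ (A ⊗ V) ◁ e ⊗≫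
    A ◁ ε_ Vᘁ V ▷ W ⊗≫ 𝟙 _
  map_add' e e' := by
    simp [monoidalComp, MonoidalPreadditive.whiskerLeft_add]
  map_smul' c e := by
    simp [monoidalComp]

theorem insertedTrace_id (ψ : Y ⊗ V ⟶ A ⊗ V) :
    insertedTrace k ψ W (𝟙 _) = partialTrace V ψ ▷ W := by
  change 𝟙 _ ⊗≫ Y ◁ η_ V Vᘁ ▷ W ⊗≫ ψ ▷ (Vᘁ ⊗ W) ⊗≫ (A ⊗ V) ◁ 𝟙 _ ⊗≫
    A ◁ ε_ Vᘁ V ▷ W ⊗≫ 𝟙 _ = _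
  rw [partialTrace]
  monoidal

theorem insertedTrace_bendIn_comp_bendOut (ψ : Y ⊗ V ⟶ A ⊗ V) (f : W ⊗ U ⟶ V) (h : V ⟶ W ⊗ U) :
    insertedTrace k ψ W (bendIn f ≫ bendOut h) =
      partialTrace U ((α_ _ _ _).hom ≫ (Y ◁ f ≫ ψ ≫ A ◁ h) ≫ (α_ _ _ _).inv) := by
  calc
    _ = 𝟙 _ ⊗≫ Y ◁ η_ V Vᘁ ▷ W ⊗≫ ψ ▷ (Vᘁ ⊗ W) ⊗≫ (A ⊗ V) ◁ (bendIn f ≫ bendOut h) ⊗≫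
        A ◁ ε_ Vᘁ V ▷ W ⊗≫ 𝟙 _ := rfl
    _ = 𝟙 _ ⊗≫ Y ◁ η_ V Vᘁ ▷ W ⊗≫ (ψ ▷ (Vᘁ ⊗ W) ≫ (A ⊗ V) ◁ bendIn f) ⊗≫
        A ◁ (V ◁ bendOut h ⊗≫ ε_ Vᘁ V ▷ W) ⊗≫ 𝟙 _ := by monoidal
    _ = 𝟙 _ ⊗≫ Y ◁ (η_ V Vᘁ ▷ W ⊗≫ V ◁ bendIn f) ⊗≫ ψ ▷ Uᘁ ⊗≫
        A ◁ (V ◁ bendOut h ⊗≫ ε_ Vᘁ V ▷ W) ⊗≫ 𝟙 _ := by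
      rw [← whisker_exchange]; monoidal
    _ = _ := by
      rw [coevaluation_comp_bendIn, bendOut_comp_evaluation, partialTrace]; monoidal

variable {I : Type*} {s : I → C} (h1 : IsScalar k (𝟙_ C))

variable (s) in
/-- The partial trace over the sum of the objects `s i`, weighted with their left loops. -/
noncomputable def kirbyTrace [Fintype I] (ψ : ∀ V, Y ⊗ V ⟶ A ⊗ V) : Y ⟶ A :=
  ∑ i, h1.coeff (leftLoop (s i)) • partialTrace (s i) (ψ (s i))

namespace IsCompleteScalarFamily

variable (hs : IsCompleteScalarFamily k s)

omit [MonoidalCategory C] [RightRigidCategory C] [TwoSidedDuals C] [MonoidalPreadditive C]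
  [MonoidalLinear k C] in
theorem exists_isotypicProjection_app_eq_sum (i : I) (X : C) :
    ∃ (n : ℕ) (π : Fin n → (X ⟶ s i)) (ι : Fin n → (s i ⟶ X)),
      (hs.isotypicProjection i).app X = ∑ a, π a ≫ ι a := by
  have factor (j : I) (x : X ⟶ s j) (y : s j ⟶ X) : ∃ (π : X ⟶ s i) (ι : s i ⟶ X),
      x ≫ y ≫ (hs.isotypicProjection i).app X = π ≫ ι := by
    have naturality : y ≫ (hs.isotypicProjection i).app X =
        (hs.isotypicProjection i).app (s j) ≫ y := (hs.isotypicProjection i).naturality y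
    rw [naturality]
    obtain rfl | hji := eq_or_ne j i
    · exact ⟨x, y, by simp [isotypicProjection_app_self]⟩
    · exact ⟨0, 0, by simp [hs.isotypicProjection_app_of_ne hji]⟩
  obtain ⟨n, c, x, y, hX⟩ := hs.complete X
  choose π ι hπι using fun a => factor (c a) (x a) (y a)
  refine ⟨n, π, ι, ?_⟩
  calc
    _ = (∑ a, x a ≫ y a) ≫ (hs.isotypicProjection i).app X := by rw [hX]; simp
    _ = _ := by simp only [Preadditive.sum_comp, Category.assoc, hπι]

include hs in
theorem leftLoop_smul_bendOut_comp_bendIn {i j : I} (h : s j ⟶ W ⊗ s i) (f : W ⊗ s i ⟶ s j)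
    {c : k} (hc : h ≫ f = c • 𝟙 _) :
    h1.coeff (leftLoop (s i)) • (bendOut h ≫ bendIn f) =
      (c * h1.coeff (leftLoop (s j))) • 𝟙 _ := by
  obtain ⟨z, hz⟩ := (hs.rightDual.scalar i).exists_smul (bendOut h ≫ bendIn f)
  change _ = z • 𝟙 (s i)ᘁ at hz
  have trace_eq : (z * h1.coeff (leftLoop (s i))) • 𝟙 (𝟙_ C) =
      (c * h1.coeff (leftLoop (s j))) • 𝟙 (𝟙_ C) := by
    calc
      _ = η_ (s i)ᘁ (s i) ≫ (bendOut h ≫ bendIn f) ▷ s i ≫ ε_ (s i) (s i)ᘁ := by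
        simp [hz, mul_smul, h1.coeff_smul_id, leftLoop]
      _ = η_ (s j)ᘁ (s j) ≫ (s j)ᘁ ◁ (h ≫ f) ≫ ε_ (s j) (s j)ᘁ :=
        (coevaluation_comp_evaluation_eq_bendOut_comp_bendIn h f).symm
      _ = _ := by simp [hc, mul_smul, h1.coeff_smul_id, leftLoop]
  rw [hz, smul_smul, mul_comm, h1.1 trace_eq]

theorem sum_leftLoop_smul_bendIn_comp_bendOut [Fintype I] (j : I) (W : C) {n : I → ℕ}
    (π : ∀ i, Fin (n i) → (W ⊗ s i ⟶ s j)) (ι : ∀ i, Fin (n i) → (s j ⟶ W ⊗ s i))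
    (hW : ∀ i, (hs.isotypicProjection j).app (W ⊗ s i) = ∑ a, π i a ≫ ι i a) :
    ∑ i, ∑ a, h1.coeff (leftLoop (s i)) • (bendIn (π i a) ≫ bendOut (ι i a)) =
      h1.coeff (leftLoop (s j)) • 𝟙 ((s j)ᘁ ⊗ W) := by
  refine hs.rightDual.hom_ext_of_comp_left fun i (g : (s i)ᘁ ⟶ (s j)ᘁ ⊗ W) => ?_
  obtain ⟨h, rfl⟩ := bendOut_surjective g
  have comp_eq_zero (l : I) (hl : l ≠ i) (a : Fin (n l)) : bendOut h ≫ bendIn (π l a) = 0 :=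
    hs.rightDual.hom_eq_zero i l hl.symm _
  have sum_eq : ∑ a, (h ≫ π i a) ≫ ι i a = h := by
    have naturality : h ≫ (hs.isotypicProjection j).app (W ⊗ s i) =
        (hs.isotypicProjection j).app (s j) ≫ h := (hs.isotypicProjection j).naturality h
    rw [hW, hs.isotypicProjection_app_self, Preadditive.comp_sum] at naturality
    simpa using naturality
  choose c hc using fun a => (hs.scalar j).exists_smul (h ≫ π i a)
  rw [Preadditive.comp_sum, Finset.sum_eq_single i
    (fun l _ hl => by simp [Preadditive.comp_sum, reassoc_of% comp_eq_zero l hl]) (by simp)]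
  calc
    _ = ∑ a, (h1.coeff (leftLoop (s i)) • (bendOut h ≫ bendIn (π i a))) ≫ bendOut (ι i a) := by
      simp [Preadditive.comp_sum]
    _ = h1.coeff (leftLoop (s j)) • bendOut (∑ a, (h ≫ π i a) ≫ ι i a) := by
      simp only [hs.leftLoop_smul_bendOut_comp_bendIn h1 _ _ (hc _), hc, Linear.smul_comp,
        Category.id_comp, bendOut_sum, bendOut_smul, Finset.smul_sum, smul_smul, mul_comm]
    _ = _ := by rw [sum_eq]; simp

include hs in
/-- Handle slide: the closed strand, coloured by the weighted sum, can be pulled across `W`. -/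
theorem kirbyTrace_tensor [Fintype I] (ψ : ∀ V, Y ⊗ V ⟶ A ⊗ V)
    (hψ : ∀ {V V'} (f : V ⟶ V'), Y ◁ f ≫ ψ V' = ψ V ≫ A ◁ f) (W : C) :
    kirbyTrace s h1 (fun V => (α_ Y W V).hom ≫ ψ (W ⊗ V) ≫ (α_ A W V).inv) =
      kirbyTrace s h1 ψ ▷ W := by
  choose n π ι hW using fun i j => hs.exists_isotypicProjection_app_eq_sum j (W ⊗ s i)
  have ψ_eq_sum (i : I) : ψ (W ⊗ s i) = ∑ j, ∑ a, Y ◁ π i j a ≫ ψ (s j) ≫ A ◁ ι i j a := by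
    have sum_eq : ∑ j, ∑ a, π i j a ≫ ι i j a = 𝟙 (W ⊗ s i) := by
      calc
        _ = (∑ j, hs.isotypicProjection j).app (W ⊗ s i) := by simp only [NatTrans.app_sum, hW]
        _ = _ := by rw [hs.sum_isotypicProjection]; rfl
    calc
      _ = ψ (W ⊗ s i) ≫ A ◁ ∑ j, ∑ a, π i j a ≫ ι i j a := by simp [sum_eq]
      _ = _ := by
        simp only [whiskerLeft_sum, Preadditive.comp_sum, MonoidalCategory.whiskerLeft_comp,
          ← Category.assoc, hψ]
  calc
    _ = ∑ i, ∑ j, ∑ a, h1.coeff (leftLoop (s i)) •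
        insertedTrace k (ψ (s j)) W (bendIn (π i j a) ≫ bendOut (ι i j a)) := by
      simp only [kirbyTrace, insertedTrace_bendIn_comp_bendOut, ψ_eq_sum, Preadditive.sum_comp,
        Preadditive.comp_sum, partialTrace_sum, Finset.smul_sum]
    _ = ∑ j, insertedTrace k (ψ (s j)) W (∑ i, ∑ a, h1.coeff (leftLoop (s i)) •
        (bendIn (π i j a) ≫ bendOut (ι i j a))) := by
      rw [Finset.sum_comm]
      simp only [map_sum, map_smul]
    _ = _ := by
      simp only [hs.sum_leftLoop_smul_bendIn_comp_bendOut h1 _ W _ _ fun i => hW i _, map_smul,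
        insertedTrace_id, kirbyTrace, sum_whiskerRight, MonoidalLinear.smul_whiskerRight]

end IsCompleteScalarFamily

end Averaging

section CenterAveraging

variable {C : Type u} [Category.{v} C] [MonoidalCategory C] {A B : Center C}

/-- A morphism `g : B.1 ⟶ A.1` conjugated by the half braidings of `B` and `A` with `V`. -/
def braidConj (g : B.1 ⟶ A.1) (V : C) : B.1 ⊗ V ⟶ A.1 ⊗ V :=
  (B.2.β V).hom ≫ V ◁ g ≫ (A.2.β V).inv

theorem braidConj_naturality (g : B.1 ⟶ A.1) {V V' : C} (f : V ⟶ V') :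
    B.1 ◁ f ≫ braidConj g V' = braidConj g V ≫ A.1 ◁ f := by
  simp only [braidConj, Category.assoc]
  rw [← halfBraiding_inv_naturality, whisker_exchange_assoc, HalfBraiding.naturality_assoc]

theorem braidConj_tensor (g : B.1 ⟶ A.1) (U V : C) :
    (α_ B.1 U V).hom ≫ braidConj g (U ⊗ V) ≫ (α_ A.1 U V).inv =
      (B.2.β U).hom ▷ V ≫ ((α_ U B.1 V).hom ≫ U ◁ braidConj g V ≫ (α_ U A.1 V).inv) ≫
        (A.2.β U).inv ▷ V := by
  simp [braidConj, halfBraiding_tensor_inv, B.2.monoidal]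

theorem braidConj_f (f : A ⟶ B) (V : C) : braidConj f.f V = f.f ▷ V := by
  rw [braidConj, ← f.comm_assoc, Iso.hom_inv_id, Category.comp_id]

theorem whiskerRight_comp_braidConj_comp_whiskerRight {A' B' : Center C} (f : B' ⟶ B)
    (g : B.1 ⟶ A.1) (f' : A ⟶ A') (V : C) :
    f.f ▷ V ≫ braidConj g V ≫ f'.f ▷ V = braidConj (f.f ≫ g ≫ f'.f) V := by
  simp [braidConj, halfBraiding_inv_comp_whiskerRight]

variable [Preadditive C] [MonoidalPreadditive C] [RightRigidCategory C] [TwoSidedDuals C]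
  {k : Type w} [CommRing k] [Linear k C] [MonoidalLinear k C] {I : Type*} [Fintype I] {s : I → C}
  (h1 : IsScalar k (𝟙_ C))

namespace IsCompleteScalarFamily

variable (hs : IsCompleteScalarFamily k s)

/-- The morphism of the center obtained by averaging a morphism of `C` over half braidings. -/
noncomputable def average (g : B.1 ⟶ A.1) : B ⟶ A where
  f := kirbyTrace s h1 (braidConj g)
  comm U := by
    have partialTrace_comp (V : C) :
        partialTrace V ((α_ _ _ _).hom ≫ braidConj g (U ⊗ V) ≫ (α_ _ _ _).inv) ≫ (A.2.β U).hom =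
          (B.2.β U).hom ≫ U ◁ partialTrace V (braidConj g V) := by
      rw [braidConj_tensor, ← comp_partialTrace_comp, ← whiskerLeft_partialTrace]
      simp
    rw [← hs.kirbyTrace_tensor h1 _ (braidConj_naturality g)]
    simp only [kirbyTrace, whiskerLeft_sum, MonoidalLinear.whiskerLeft_smul, Preadditive.sum_comp,
      Preadditive.comp_sum, Linear.smul_comp, Linear.comp_smul, partialTrace_comp]

theorem comp_average_comp {A' B' : Center C} (f : B' ⟶ B) (g : B.1 ⟶ A.1) (f' : A ⟶ A') :
    f ≫ hs.average h1 g ≫ f' = hs.average h1 (f.f ≫ g ≫ f'.f) := by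
  ext
  simp only [Center.comp_f, average, kirbyTrace, Preadditive.sum_comp, Preadditive.comp_sum,
    Linear.smul_comp, Linear.comp_smul, comp_partialTrace_comp,
    whiskerRight_comp_braidConj_comp_whiskerRight]

theorem average_f (f : A ⟶ B) : hs.average h1 f.f =
    (∑ i, h1.coeff (rightLoop (s i)) * h1.coeff (leftLoop (s i))) • f := by
  have partialTrace_eq (i : I) :
      partialTrace (s i) (f.f ▷ s i) = h1.coeff (rightLoop (s i)) • f.f := by
    rw [partialTrace_whiskerRight]
    conv_lhs => rw [← h1.coeff_smul_id (rightLoop (s i))]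
    simp
  ext
  simp only [average, kirbyTrace, braidConj_f, partialTrace_eq, smul_smul, Finset.sum_smul,
    center_sum_f, center_smul_f, mul_comm]

include hs in
/-- Maschke's averaging argument, with division by the dimension. -/
theorem center_isVonNeumannRegular (hC : IsVonNeumannRegular C)
    (hd : IsUnit (∑ i, h1.coeff (rightLoop (s i)) * h1.coeff (leftLoop (s i)))) :
    IsVonNeumannRegular (Center C) := by
  intro A B f
  obtain ⟨g, hg⟩ := hC f.f
  obtain ⟨d, hd⟩ := hd
  refine ⟨(↑d⁻¹ : k) • hs.average h1 g, ?_⟩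
  calc
    _ = (↑d⁻¹ : k) • hs.average h1 (f.f ≫ g ≫ f.f) := by simp [hs.comp_average_comp h1]
    _ = f := by rw [hg, hs.average_f h1, ← hd, smul_smul, d.inv_mul, one_smul]

end IsCompleteScalarFamily

end CenterAveraging

/-! ### Semisimple categories -/

section Semisimple

theorem IsAbelian.hasKernels {D : Type u} [Category.{v} D] [Preadditive D] (hD : IsAbelian D) :
    HasKernels D := by
  obtain ⟨A, rfl⟩ := hD
  infer_instance

theorem IsAbelian.hasPullbacks {D : Type u} [Category.{v} D] [Preadditive D] (hD : IsAbelian D) :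
    HasPullbacks D := by
  obtain ⟨A, rfl⟩ := hD
  infer_instance

variable {D : Type u} [Category.{v} D] [Preadditive D] [HasFiniteBiproducts D]

/-- Finite semisimplicity of an object: being isomorphic to a biproduct of finitely many simple
objects. -/
def IsFiniteSumOfSimples (X : D) : Prop :=
  ∃ (n : ℕ) (S : Fin n → D), (∀ j, Simple (S j)) ∧ Nonempty (X ≅ ⨁ S)

namespace IsFiniteSumOfSimples

theorem of_finite {J : Type*} [Finite J] {S : J → D} (hS : ∀ j, Simple (S j)) {X : D}
    (e : X ≅ ⨁ S) : IsFiniteSumOfSimples X := by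
  have := Fintype.ofFinite J
  exact ⟨Fintype.card J, S ∘ (Fintype.equivFin J).symm, fun _ => hS _,
    ⟨e ≪≫ (biproduct.whiskerEquiv (Fintype.equivFin J).symm fun _ => Iso.refl _).symm⟩⟩

theorem of_isZero {X : D} (hX : IsZero X) : IsFiniteSumOfSimples X :=
  ⟨0, Fin.elim0, fun j => j.elim0,
    ⟨hX.iso ((IsZero.iff_id_eq_zero _).2 (biproduct.hom_ext _ _ fun j => j.elim0))⟩⟩

theorem of_simple (X : D) [Simple X] : IsFiniteSumOfSimples X :=
  ⟨1, fun _ => X, fun _ => inferInstance, ⟨(biproductUniqueIso fun _ : Fin 1 => X).symm⟩⟩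

theorem of_isBilimit {X Y : D} (hX : IsFiniteSumOfSimples X) (hY : IsFiniteSumOfSimples Y)
    {b : BinaryBicone X Y} (hb : b.IsBilimit) : IsFiniteSumOfSimples b.pt := by
  obtain ⟨n, S, hS, ⟨e⟩⟩ := hX
  obtain ⟨m, T, hT, ⟨f⟩⟩ := hY
  have simple_sum : ∀ j, Simple (Sum.elim S T j) := by
    rintro (j | j)
    exacts [hS j, hT j]
  have hX : IsColimit (Cofan.mk X fun j => biproduct.ι S j ≫ e.inv) :=
    (biproduct.isColimit S).ofIsoColimit (Cofan.ext e.symm fun _ => rfl)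
  have hY : IsColimit (Cofan.mk Y fun j => biproduct.ι T j ≫ f.inv) :=
    (biproduct.isColimit T).ofIsoColimit (Cofan.ext f.symm fun _ => rfl)
  exact of_finite simple_sum ((Cofan.combPairIsColimit hX hY hb.isColimit).coconePointUniqueUpToIso
    (biproduct.isColimit (Sum.elim S T)))

end IsFiniteSumOfSimples

theorem isSemisimple_of_isFiniteSumOfSimples (h : ∀ X : D, IsFiniteSumOfSimples X) :
    IsSemisimple D := by
  intro X
  obtain ⟨n, S, hS, ⟨e⟩⟩ := h X
  let T : ULift.{v} (Fin n) → D := S ∘ ULift.down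
  exact ⟨_, T, (biproduct.bicone T).toCocone, fun _ => hS _, ⟨biproduct.isColimit T⟩,
    ⟨e ≪≫ biproduct.whiskerEquiv (g := T) Equiv.ulift.symm fun _ => Iso.refl _⟩⟩

theorem exists_isIso_comp_π [HasKernels D] {J : Type*} [Finite J] {S : J → D}
    (hS : ∀ j, Simple (S j)) {T : D} [Simple T] {f : T ⟶ ⨁ S} (hf : f ≠ 0) :
    ∃ j, IsIso (f ≫ biproduct.π S j) := by
  obtain ⟨j, hj⟩ : ∃ j, f ≫ biproduct.π S j ≠ 0 := by
    by_contra! h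
    exact hf (biproduct.hom_ext _ _ fun j => by simp [h])
  have := hS j
  exact ⟨j, isIso_of_hom_simple hj⟩

end Semisimple

section SemisimpleLinear

variable {k : Type w} [Field k] {D : Type u} [Category.{v} D] [Preadditive D] [Linear k D]

variable (k) in
theorem finite_of_isColimit_cofan {J : Type*} {S : J → D} (hS : ∀ j, 𝟙 (S j) ≠ 0) {c : Cofan S}
    (hc : IsColimit c) [Module.Finite k (c.pt ⟶ c.pt)] : Finite J := by
  classical
  let p (j : J) : c.pt ⟶ S j := Cofan.IsColimit.desc hc (Pi.single j (𝟙 (S j)))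
  have inj_p (l j : J) : c.inj l ≫ p j = Pi.single (M := fun l => S l ⟶ S j) j (𝟙 (S j)) l :=
    Cofan.IsColimit.fac ..
  suffices LinearIndependent k fun j => p j ≫ c.inj j from this.finite
  refine linearIndependent_iff'.2 fun t a h j hj => ?_
  have smul_id_eq_zero : a j • 𝟙 (S j) = 0 :=
    calc a j • 𝟙 (S j) = c.inj j ≫ (∑ l ∈ t, a l • (p l ≫ c.inj l)) ≫ p j := by
          rw [Preadditive.sum_comp, Preadditive.comp_sum, Finset.sum_eq_single_of_mem j hj]
          · simp [inj_p]
          · intro l _ hl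
            simp [inj_p, Pi.single_eq_of_ne hl]
      _ = 0 := by rw [h, zero_comp, comp_zero]
  exact (smul_eq_zero.1 smul_id_eq_zero).resolve_right (hS j)

variable (k) in
theorem IsSemisimple.isFiniteSumOfSimples [HasFiniteBiproducts D] (hD : IsSemisimple D) (X : D)
    [Module.Finite k (X ⟶ X)] : IsFiniteSumOfSimples X := by
  obtain ⟨J, S, c, hS, ⟨hc⟩, ⟨e⟩⟩ := hD X
  have : Module.Finite k (c.pt ⟶ c.pt) :=
    Module.Finite.equiv (Linear.homCongr k e e)
  have : Finite J := finite_of_isColimit_cofan k (fun j => id_nonzero (S j)) hc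
  exact .of_finite hS (e ≪≫ hc.coconePointUniqueUpToIso (biproduct.isColimit S))

theorem IsFiniteSumOfSimples.exists_retraction [HasFiniteBiproducts D] [HasKernels D] {T X : D}
    (hX : IsFiniteSumOfSimples X) [Simple T] {f : T ⟶ X} (hf : f ≠ 0) :
    ∃ r : X ⟶ T, f ≫ r = 𝟙 T := by
  obtain ⟨n, S, hS, ⟨e⟩⟩ := hX
  obtain ⟨j, hj⟩ := exists_isIso_comp_π hS (f := f ≫ e.hom) (by simpa using hf)
  exact ⟨e.hom ≫ biproduct.π S j ≫ inv ((f ≫ e.hom) ≫ biproduct.π S j), by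
    simp only [← Category.assoc, IsIso.hom_inv_id]⟩

theorem finrank_end_lt {X Y : D} {i : Y ⟶ X} {p : X ⟶ Y} (hip : i ≫ p = 𝟙 Y) (hi : ¬ IsIso i)
    [Module.Finite k (X ⟶ X)] : Module.finrank k (Y ⟶ Y) < Module.finrank k (X ⟶ X) := by
  let φ : (Y ⟶ Y) →ₗ[k] (X ⟶ X) := Linear.leftComp k X p ∘ₗ Linear.rightComp k Y i
  have φ_injective : Function.Injective φ := fun f g hfg => by
    simpa [φ, hip, reassoc_of% hip] using congrArg (fun t => i ≫ t ≫ p) hfg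
  rw [← LinearMap.finrank_range_of_inj φ_injective]
  refine Submodule.finrank_lt fun hφ => hi ?_
  obtain ⟨f, hf⟩ := LinearMap.range_eq_top.1 hφ (𝟙 X)
  have : IsSplitMono i := ⟨⟨p, hip⟩⟩
  have : IsSplitEpi i := ⟨⟨p ≫ f, by simpa [φ] using hf⟩⟩
  exact isIso_of_mono_of_isSplitEpi i

end SemisimpleLinear

namespace IsVonNeumannRegular

variable {D : Type u} [Category.{v} D] [Preadditive D] (hD : IsVonNeumannRegular D)
include hD

theorem simple_of_isScalar {k : Type w} [Field k] [Linear k D] {X : D} (hX : IsScalar k X) :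
    Simple X where
  mono_isIso_iff_nonzero f _ := by
    refine ⟨fun _ hf => hX.id_ne_zero ((cancel_epi f).1 (by simp [hf])), fun hf => ?_⟩
    obtain ⟨r, hr⟩ := hD.exists_retraction f
    exact hX.isIso_of_retraction hr hf

theorem exists_proper_retract {X : D} (hX : 𝟙 X ≠ 0) (hX' : ¬ Simple X) :
    ∃ (A : D) (i : A ⟶ X) (r : X ⟶ A), i ≫ r = 𝟙 A ∧ i ≠ 0 ∧ ¬ IsIso i := by
  obtain ⟨A, i, hm, hi, hi'⟩ : ∃ (A : D) (i : A ⟶ X), Mono i ∧ i ≠ 0 ∧ ¬ IsIso i := by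
    by_contra! h
    exact hX' ⟨fun i _ => ⟨fun _ hi => hX ((cancel_epi i).1 (by simp [hi])), h _ i inferInstance⟩⟩
  obtain ⟨r, hr⟩ := hD.exists_retraction i
  exact ⟨A, i, r, hr, hi, hi'⟩

theorem isFiniteSumOfSimples (k : Type w) [Field k] [Linear k D] [HasFiniteBiproducts D]
    [HasKernels D] (hfin : ∀ X : D, Module.Finite k (X ⟶ X)) (X : D) :
    IsFiniteSumOfSimples X := by
  induction hn : Module.finrank k (X ⟶ X) using Nat.strong_induction_on generalizing X with
  | _ n ih =>
  subst hn
  by_cases hX : 𝟙 X = 0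
  · exact .of_isZero ((IsZero.iff_id_eq_zero X).2 hX)
  by_cases hX' : Simple X
  · exact .of_simple X
  obtain ⟨A, i, r, hir, hi, hi'⟩ := hD.exists_proper_retract hX hX'
  have : IsSplitEpi r := ⟨⟨i, hir⟩⟩
  let b := binaryBiconeOfIsSplitEpiOfKernel (kernelIsKernel r)
  have kernel_ι_not_isIso : ¬ IsIso (kernel.ι r) := fun _ => by
    have hr : r = 0 := (cancel_epi (kernel.ι r)).1 (by simp)
    rw [hr, comp_zero] at hir
    exact hi (by rw [← Category.id_comp i, ← hir, zero_comp])
  exact IsFiniteSumOfSimples.of_isBilimit (ih _ (finrank_end_lt b.inl_fst kernel_ι_not_isIso) _ rfl)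
    (ih _ (finrank_end_lt hir hi') _ rfl)
    (isBilimitBinaryBiconeOfIsSplitEpiOfKernel (kernelIsKernel r))

end IsVonNeumannRegular

theorem isScalar_of_simple (k : Type w) [Field k] [IsAlgClosed k] {D : Type u} [Category.{v} D]
    [Preadditive D] [Linear k D] [HasKernels D] (X : D) [Simple X] [Module.Finite k (X ⟶ X)] :
    IsScalar k X :=
  ⟨smul_left_injective k (id_nonzero X), fun f => endomorphism_simple_eq_smul_id k f⟩

theorem FusionCategory.isSemisimple (k : Type w) [Field k] (D : Type u) [Category.{v} D]
    [MonoidalCategory D] [Preadditive D] [Linear k D] [FusionCategory k D] : IsSemisimple D := by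
  have := FusionCategory.hasFiniteBiproducts (k := k) (C := D)
  have hD := (isCompleteScalarFamily_scalarRep k D).isVonNeumannRegular
  refine isSemisimple_of_isFiniteSumOfSimples fun X => ?_
  obtain ⟨n, S, hS, hX⟩ := FusionCategory.exists_iso_biproduct (k := k) X
  exact ⟨n, S, fun j => hD.simple_of_isScalar (hS j), hX⟩

/-! ### The center as a fusion category -/

section FusionCriterion

variable {k : Type w} [Field k] {D : Type u} [Category.{v} D] [Preadditive D] [Linear k D]
  [HasFiniteBiproducts D] [HasKernels D]

theorem finite_scalarClasses_of_exists_hom_ne_zero (hD : IsVonNeumannRegular D) {I : Type*}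
    [Finite I] {R : I → D} (hR : ∀ i, IsFiniteSumOfSimples (R i))
    (h : ∀ X : D, IsScalar k X → ∃ (i : I) (a : X ⟶ R i), a ≠ 0) : (scalarClasses k D).Finite := by
  choose n S hS e using hR
  refine (Set.finite_range fun x : Σ i, Fin (n i) =>
    Quotient.mk (isIsomorphicSetoid D) (S x.1 x.2)).subset ?_
  rintro _ ⟨X, hX, rfl⟩
  have := hD.simple_of_isScalar hX
  obtain ⟨i, a, ha⟩ := h X hX
  obtain ⟨j, hj⟩ := exists_isIso_comp_π (hS i) (f := a ≫ (e i).some.hom) (by simpa using ha)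
  exact ⟨⟨i, j⟩, Quotient.sound ⟨(asIso ((a ≫ (e i).some.hom) ≫ biproduct.π (S i) j)).symm⟩⟩

theorem IsVonNeumannRegular.fusionCategory (hD : IsVonNeumannRegular D) [IsAlgClosed k]
    [MonoidalCategory D] [MonoidalPreadditive D] [MonoidalLinear k D] [RigidCategory D]
    (hfin : ∀ X : D, Module.Finite k (X ⟶ X)) (h1 : IsScalar k (𝟙_ D)) {I : Type*} [Finite I]
    {R : I → D} (hR : ∀ X : D, IsScalar k X → ∃ (i : I) (a : X ⟶ R i), a ≠ 0) :
    FusionCategory k D where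
  rigid := ⟨inferInstance⟩
  exists_iso_biproduct X := by
    obtain ⟨n, S, hS, e⟩ := hD.isFiniteSumOfSimples k hfin X
    exact ⟨n, S, fun j => have := hS j; isScalar_of_simple k (S j), e⟩
  hom_eq_zero X Y hX hY hXY f := by
    have := hD.simple_of_isScalar hX
    have := hD.simple_of_isScalar hY
    by_contra hf
    have := isIso_of_hom_simple hf
    exact hXY ⟨asIso f⟩
  finite_scalarClasses :=
    finite_scalarClasses_of_exists_hom_ne_zero hD (fun i => hD.isFiniteSumOfSimples k hfin (R i)) hR
  unit_scalar := h1

end FusionCriterion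

section CenterFusion

variable {C : Type u} [Category.{v} C] [MonoidalCategory C] [Preadditive C] [MonoidalPreadditive C]

instance : MonoidalPreadditive (Center C) where
  whiskerLeft_zero {X _ _} := Center.ext _ _ (MonoidalPreadditive.whiskerLeft_zero (X := X.1))
  zero_whiskerRight {X _ _} := Center.ext _ _ (MonoidalPreadditive.zero_whiskerRight (X := X.1))
  whiskerLeft_add f g := Center.ext _ _ (MonoidalPreadditive.whiskerLeft_add f.f g.f)
  add_whiskerRight f g := Center.ext _ _ (MonoidalPreadditive.add_whiskerRight f.f g.f)

section CommRing

variable {k : Type w} [CommRing k] [Linear k C] [MonoidalLinear k C]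

instance : MonoidalLinear k (Center C) where
  whiskerLeft_smul X _ _ r f := Center.ext _ _ (MonoidalLinear.whiskerLeft_smul X.1 r f.f)
  smul_whiskerRight r _ _ f X := Center.ext _ _ (MonoidalLinear.smul_whiskerRight r f.f X.1)

theorem center_finite_hom [IsNoetherianRing k] (A B : Center C) [Module.Finite k (A.1 ⟶ B.1)] :
    Module.Finite k (A ⟶ B) :=
  let φ : (A ⟶ B) →ₗ[k] (A.1 ⟶ B.1) :=
    { toFun := fun f => f.f, map_add' := fun _ _ => rfl, map_smul' := fun _ _ => rfl }
  Module.Finite.of_injective φ fun _ _ => Center.ext _ _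

theorem center_isScalar {A : Center C} (hA : IsScalar k A.1) : IsScalar k A :=
  ⟨fun _ _ h => hA.1 (congrArg Center.Hom.f h), fun f =>
    (hA.2 f.f).imp fun _ => Center.ext _ _⟩

end CommRing

instance : (Center.forget C).Faithful where
  map_injective := Center.ext _ _

theorem center_simple [RigidCategory C] [HasPullbacks C] (A : Center C) [h : Simple A.1] :
    Simple A :=
  have : Simple ((Center.forget C).obj A) := h
  (Center.forget C).simple_of_simple_obj A

theorem IsCompleteScalarFamily.center_finite_end {k : Type w} [Field k] [Linear k C]
    [MonoidalLinear k C] {I : Type*} {s : I → C} (hs : IsCompleteScalarFamily k s) (A : Center C) :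
    Module.Finite k (A ⟶ A) :=
  have := hs.finite_hom A.1 A.1
  center_finite_hom A A

theorem IsCofree.exists_center_unit_hom {k : Type w} [CommRing k] [Linear k C]
    [MonoidalLinear k C] [RigidCategory C] {R : C} {u : ∀ V, R ⊗ V ⟶ V ⊗ 𝟙_ C}
    (hu : IsCofree u) (h : 𝟙 (𝟙_ C) ≠ 0) :
    ∃ η : 𝟙_ (Center C) ⟶ hu.center, η ≠ 0 ∧ η.f = hu.ofNatTrans k (𝟙 (𝟭 C)) := by
  obtain ⟨η, hη⟩ := hu.exists_center_lift (𝟙_ (Center C)) (𝟙 (𝟙_ C))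
  have β_unit (V : C) : ((λ_ V).hom ≫ (ρ_ V).inv) ≫ V ◁ 𝟙 (𝟙_ C) =
      (λ_ V).hom ≫ (𝟙 (𝟭 C) : 𝟭 C ⟶ 𝟭 C).app V ≫ (ρ_ V).inv := by simp
  exact ⟨η, hu.center_lift_ne_zero h hη, hu.hom_ext fun V =>
    (hη V).trans ((β_unit V).trans (hu.ofNatTrans_spec (k := k) _ V).symm)⟩

variable [RightRigidCategory C] [TwoSidedDuals C] [HasFiniteBiproducts C] {k : Type w} [Field k]
  [Linear k C] [MonoidalLinear k C] {I : Type*} [Fintype I] {s : I → C}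

namespace IsCompleteScalarFamily

variable (hs : IsCompleteScalarFamily k s) (h1 : IsScalar k (𝟙_ C))
include hs

theorem sum_loop_ne_zero_of_isSemisimple (h : IsSemisimple (Center C)) :
    ∑ i, h1.coeff (rightLoop (s i)) * h1.coeff (leftLoop (s i)) ≠ 0 := by
  have := center_hasFiniteBiproducts (C := C)
  have := (center_isAbelian hs.isAbelian).hasKernels
  have := hs.isAbelian.hasPullbacks
  have : Simple (𝟙_ (Center C)).1 := hs.isVonNeumannRegular.simple_of_isScalar h1
  have := center_simple (𝟙_ (Center C))
  obtain ⟨R, u, hu⟩ := hs.exists_isCofree (𝟙_ C)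
  obtain ⟨η, η_ne_zero, η_f⟩ := hu.exists_center_unit_hom (k := k) h1.id_ne_zero
  have := hs.center_finite_end hu.center
  obtain ⟨r, hr⟩ := (h.isFiniteSumOfSimples k hu.center).exists_retraction η_ne_zero
  exact hs.sum_loop_ne_zero h1 hu (r := r.f) r.comm
    ((congrArg (· ≫ r.f) η_f).symm.trans (congrArg Center.Hom.f hr))

variable (hd : ∑ i, h1.coeff (rightLoop (s i)) * h1.coeff (leftLoop (s i)) ≠ 0)
include hd

theorem center_isSemisimple : IsSemisimple (Center C) := by
  have := center_hasFiniteBiproducts (C := C)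
  have := (center_isAbelian hs.isAbelian).hasKernels
  have hZ := hs.center_isVonNeumannRegular h1 hs.isVonNeumannRegular hd.isUnit
  exact isSemisimple_of_isFiniteSumOfSimples (hZ.isFiniteSumOfSimples k hs.center_finite_end)

theorem center_fusionCategory [IsAlgClosed k] : FusionCategory k (Center C) := by
  have := center_hasFiniteBiproducts (C := C)
  have := (center_isAbelian hs.isAbelian).hasKernels
  have hZ := hs.center_isVonNeumannRegular h1 hs.isVonNeumannRegular hd.isUnit
  have : RigidCategory (Center C) := BraidedCategory.rigidCategoryOfRightRigidCategory
  choose R u hu using fun i => hs.exists_isCofree (s i)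
  refine hZ.fusionCategory hs.center_finite_end (center_isScalar (A := 𝟙_ (Center C)) h1)
    (R := fun i => (hu i).center) fun A hA => ?_
  obtain ⟨i, g, hg⟩ : ∃ (i : I) (g : A.1 ⟶ s i), g ≠ 0 := by
    by_contra! h
    exact hA.id_ne_zero (Center.ext _ _ (hs.hom_ext_of_comp_right fun i y => by
      rw [h i (_ ≫ y), h i (_ ≫ y)]))
  obtain ⟨a, ha⟩ := (hu i).exists_center_lift A g
  exact ⟨i, a, (hu i).center_lift_ne_zero hg ha⟩

end IsCompleteScalarFamily

end CenterFusion

section PivotalFusion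

variable {C : Type u} [Category.{v} C] [MonoidalCategory C] [PivotalCategory C]

theorem leftDim_eq_leftLoop (X : C) : leftDim X = leftLoop X := by
  rw [leftDim, leftTrace, whiskerLeft_id, Category.id_comp]
  rfl

theorem rightDim_eq_rightLoop (X : C) : rightDim X = rightLoop X := by
  rw [rightDim, rightTrace, id_whiskerRight, Category.id_comp]
  rfl

theorem fusionDim_eq_sum_loop (k : Type w) [CommRing k] (C : Type u) [Category.{v} C]
    [MonoidalCategory C] [PivotalCategory C] [Preadditive C] [Linear k C] [FusionCategory k C] :
    fusionDim k C = ∑ q : ScalarClass k C,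
      (FusionCategory.unit_scalar (k := k) (C := C)).coeff (rightLoop (scalarRep k q)) *
        (FusionCategory.unit_scalar (k := k) (C := C)).coeff (leftLoop (scalarRep k q)) := by
  simp only [← leftDim_eq_leftLoop, ← rightDim_eq_rightLoop, scalarRep]
  exact (Finset.sum_coe_sort _ _).symm

end PivotalFusion

end FusionCenter

theorem mainTheorem4_general {k : Type w} [Field k] {C : Type u} [Category.{v} C]
    [MonoidalCategory C] [Preadditive C] [Linear k C] [MonoidalPreadditive C] [MonoidalLinear k C]
    [HasFiniteBiproducts C] [RightRigidCategory C] [FusionCenter.TwoSidedDuals C]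
    {I : Type*} [Fintype I] {s : I → C} (hs : FusionCenter.IsCompleteScalarFamily k s)
    (h1 : FusionCenter.IsScalar k (𝟙_ C)) :
    let d := ∑ i, h1.coeff (FusionCenter.rightLoop (s i)) * h1.coeff (FusionCenter.leftLoop (s i))
    FusionCenter.IsAbelian (Center C) ∧ (FusionCenter.IsSemisimple (Center C) ↔ d ≠ 0) ∧
      (IsAlgClosed k → (FusionCenter.FusionCategory k (Center C) ↔ d ≠ 0)) := by
  refine ⟨FusionCenter.center_isAbelian hs.isAbelian,
    ⟨hs.sum_loop_ne_zero_of_isSemisimple h1, hs.center_isSemisimple h1⟩,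
    fun _ => ⟨fun _ => hs.sum_loop_ne_zero_of_isSemisimple h1 ?_, fun hd => ?_⟩⟩
  · exact FusionCenter.FusionCategory.isSemisimple k _
  · exact hs.center_fusionCategory h1 hd

theorem mainTheorem4 {k : Type w} [Field k] {C : Type u} [Category.{v} C] [MonoidalCategory C]
    [Preadditive C] [Linear k C] [MonoidalPreadditive C] [MonoidalLinear k C]
    [FusionCenter.FusionCategory k C] [FusionCenter.PivotalCategory C] :
    FusionCenter.IsAbelian (Center C) ∧
    (FusionCenter.IsSemisimple (Center C) ↔ FusionCenter.fusionDim k C ≠ 0) ∧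
    (IsAlgClosed k →
      (FusionCenter.FusionCategory k (Center C) ↔ FusionCenter.fusionDim k C ≠ 0)) := by
  have := FusionCenter.FusionCategory.hasFiniteBiproducts (k := k) (C := C)
  rw [FusionCenter.fusionDim_eq_sum_loop]
  exact mainTheorem4_general (FusionCenter.isCompleteScalarFamily_scalarRep k C) _
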